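/- **Setting.** Let $\mathcal S,\mathcal A$ be finite, $c:\mathcal S\times\mathcal A\to[0,1]$, $\gamma\in[0,1)$, $\zeta\in[0,1]$. Let $\vartheta$ be a randomized stationary policy, $\overline{\mathbb P}$ a transition kernel, and for each $s$ let $\mathcal D_s\subseteq\Delta_{\mathcal S}^{|\mathcal A|}$ be nonempty and convex. Let $V^\vartheta_{\mathbb P}(s)=\mathbb E[\sum_{t\ge0}\gamma^tc(s_t,a_t)\mid s_0=s]$ with $a_t\sim\vartheta(\cdot|s_t)$, $s_{t+1}\sim\mathbb P_{s_t,a_t}$, and let $V^\vartheta_r(s)=\sup_{\mathbb P\in\mathcal P}V^\vartheta_{\mathbb P}(s)$, where $\mathcal P=\prod_s\{(1-\zeta)\overline{\mathbb P}_s+\zeta D: D\in\mathcal D_s\}$. For $\pi\in\Pi=\prod_s\mathcal D_s$ let $\mathcal V^\pi$ be the discounted value function of the Markov chain with transitions $\mathfrak P(s'|s,\pi(s))=\sum_a\vartheta(a|s)[(1-\zeta)\overline{\mathbb P}_{s,a}(s')+\zeta\pi(s)_a(s')]$ and cost $\mathfrak C(s)=-\sum_a\vartheta(a|s)c(s,a)$,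 and put $\mathcal V^*(s)=\inf_{\pi\in\Pi}\mathcal V^\pi(s)$. **Regularizer.** For every $s$ let $w_s$ be convex on $\Delta_{\mathcal S}^{|\mathcal A|}$ with $0\le w_s\le\overline w$ there, where $0<\overline w<\infty$ (for instance $\overline w=\sup_s\sup w_s$), and suppose that for some $\mu_w>0$ its Bregman divergence satisfies $$w_s(D')-w_s(D)-\langle\nabla w_s(D),D'-D\rangle\ \ge\ \frac{\mu_w}2\sum_a\vartheta(a|s)\|D_a-D'_a\|_1^2 ,\qquad D,D'\in\Delta_{\mathcal S}^{|\mathcal A|},$$ where $\langle\nabla w_s(D),D'-D\rangle$ is the one-sided directional derivative (if it is $-\infty$, the divergence is $+\infty$ and the condition holds). **SE operator with $l$ steps.** Given $\pi$, put $R_0=I$, $\hat{\mathcal V}_0=\mathfrak C$. In step $i=1,\dots,l$ draw, for every $s$, fresh independent samples $a\sim\vartheta(\cdot|s)$, $s'\sim\overline{\mathbb P}_{s,a}$, let $\hat P_i$ be the $0$-$1$ matrix of the sampled pairs $(s,s')$, and set $R_i=R_{i-1}((1-\zeta)\hat P_i+\zeta D^{\pi,\vartheta})$ with $D^{\pi,\vartheta}(s,s')=\sum_a\vartheta(a|s)\pi(s)_a(s')$,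 and $\hat{\mathcal V}_i=\hat{\mathcal V}_{i-1}+\gamma^iR_i\mathfrak C$. Return $\hat{\mathcal V}^\pi=\hat{\mathcal V}_l$. This uses $l|\mathcal S|$ samples. **SFRPE.** From an arbitrary $\pi_0\in\Pi$, in iteration $k=0,1,\dots$ run SE on $\pi_k$ with fresh samples to get $\hat{\mathcal V}^{\pi_k}$, and for every $s$ let $$\pi_{k+1}(s)\in\operatorname*{argmin}_{D\in\mathcal D_s}\ \gamma\zeta\sum_{t=0}^k\beta_t\sum_{a,s'}D_a(s')\vartheta(a|s)\hat{\mathcal V}^{\pi_t}(s')+\lambda_kw_s(D),$$ ties being broken by any rule depending on the samples drawn so far. The output after $k\ge1$ iterations is $\sum_{t=1}^k\theta_t\hat{\mathcal V}^{\pi_t}$ with $\theta_t=\beta_t/\sum_{j=1}^k\beta_j$. Take $$\beta_k=k^{1/2},\qquad \lambda_k=\frac{(k+1)\gamma\zeta}{2(1-\gamma)\sqrt{\mu_w\overline w}} .$$ **Theorem.** $\mathcal V^*=-V^\vartheta_r$. Moreover, there are an absolute constant $C$ and a choice of the number of steps $l=l(\gamma,\epsilon)$ such that the following holds for all data as above and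 all $\epsilon>0$. Let $k_\epsilon$ be the integer part of $1+\frac{64\gamma^2\zeta^2\overline w}{\mu_w(1-\gamma)^4\epsilon^2}$. 1. For every run of SFRPE with the SE operator and every $k\ge k_\epsilon$, the output is an $\epsilon$-estimator of $\mathcal V^*$ in expectation: $$-\epsilon\le\mathbb E\Big[\sum_{t=1}^k\theta_t\hat{\mathcal V}^{\pi_t}(s)\Big]-\mathcal V^*(s)\le\epsilon\qquad\text{for every } s\in\mathcal S .$$ 2. If $\epsilon\le\min\{\frac12,1-\gamma\}$, the total number $(k_\epsilon+1)\,l\,|\mathcal S|$ of samples drawn in the iterations $0,\dots,k_\epsilon$ is at most $$C\left(\frac{\gamma^2\zeta^2|\mathcal S|\,\overline w\,\log(1/\epsilon)}{\mu_w\epsilon^2(1-\gamma)^5}+\frac{|\mathcal S|}{1-\gamma}\log\frac1\epsilon\right);$$ for all $\epsilon\le\frac12$ the same holds with $\log(1/\epsilon)$ replaced by $\log\frac{1}{(1-\gamma)\epsilon}$. 3. If $|\mathcal S|\ge2$ and $w_s(D)=\sum_a\vartheta(a|s)\sum_{s'}D_a(s')\log D_a(s')+\log|\mathcal S|$, then 1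 and 2 hold with $\overline w=\log|\mathcal S|$ and $\mu_w=1$. -/

import Mathlib

open MeasureTheory ProbabilityTheory Set

universe u v w

noncomputable section

/-- The product `Δ_S^A` of probability simplices: families `D` with `D a` a distribution on `S`. -/
def kernelSimplex (S : Type u) (A : Type v) [Fintype S] : Set (A → S → ℝ) :=
  {D | ∀ a, D a ∈ stdSimplex ℝ S}

/-- A robust policy evaluation problem: a finite MDP with costs in `[0, 1]`, discount factor
`γ`, a randomized stationary policy `ϑ` to be evaluated, a nominal kernel `Pbar`, and an
s-rectangular ambiguity set given by the convex sets `amb s ⊆ Δ_S^A` and the weight `ζ`. -/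
structure RobustEval (S : Type u) (A : Type v) [Fintype S] [Fintype A] where
  cost : S → A → ℝ
  cost_mem : ∀ s a, cost s a ∈ Icc (0 : ℝ) 1
  γ : ℝ
  γ_nonneg : 0 ≤ γ
  γ_lt_one : γ < 1
  ϑ : S → A → ℝ
  ϑ_mem : ∀ s, ϑ s ∈ stdSimplex ℝ A
  Pbar : S → A → S → ℝ
  Pbar_mem : ∀ s, Pbar s ∈ kernelSimplex S A
  ζ : ℝ
  ζ_mem : ζ ∈ Icc (0 : ℝ) 1
  amb : S → Set (A → S → ℝ)
  amb_subset : ∀ s, amb s ⊆ kernelSimplex S A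
  amb_nonempty : ∀ s, (amb s).Nonempty
  amb_convex : ∀ s, Convex ℝ (amb s)

namespace RobustEval

variable {S : Type u} {A : Type v} [Fintype S] [DecidableEq S] [Fintype A]

/-! ### The robust value function -/

/-- Transition matrix of the states when `ϑ` is run under the kernel `P`. -/
def chain (M : RobustEval S A) (P : S → A → S → ℝ) : Matrix S S ℝ :=
  Matrix.of fun s s' => ∑ a, M.ϑ s a * P s a s'

/-- The value `V_P^ϑ(s) = E[∑ γ^t c(s_t, a_t) | s_0 = s]`; here `(chain P ^ t) s s'` is the
probability of `s_t = s'` given `s_0 = s`, and `a_t ∼ ϑ(·|s_t)`. -/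
def value (M : RobustEval S A) (P : S → A → S → ℝ) (s : S) : ℝ :=
  ∑' t : ℕ, M.γ ^ t * ∑ s', (M.chain P ^ t) s s' * ∑ a, M.ϑ s' a * M.cost s' a

/-- The s-rectangular ambiguity set: `P s = (1 - ζ) Pbar s + ζ D` with `D ∈ amb s`, separately
for every state. -/
def ambiguitySet (M : RobustEval S A) : Set (S → A → S → ℝ) :=
  {P | ∀ s, ∃ D ∈ M.amb s, P s = (1 - M.ζ) • M.Pbar s + M.ζ • D}

/-- The robust value `V_r^ϑ(s)`: the worst case of `V_P^ϑ(s)` over the ambiguity set. -/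
def robustValue (M : RobustEval S A) (s : S) : ℝ :=
  sSup ((fun P => M.value P s) '' M.ambiguitySet)

/-! ### The MDP of nature -/

/-- Probability that nature's MDP moves from `s` to `s'` under the action `D`. -/
def natureKernel (M : RobustEval S A) (s : S) (D : A → S → ℝ) (s' : S) : ℝ :=
  ∑ a, ((1 - M.ζ) * M.Pbar s a s' + M.ζ * D a s') * M.ϑ s a

/-- Cost of nature. -/
def natureCost (M : RobustEval S A) (s : S) : ℝ :=
  -∑ a, M.ϑ s a * M.cost s a

/-- Non-randomized stationary policies of nature. -/
def policies (M : RobustEval S A) : Set (S → A → S → ℝ) :=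
  {π | ∀ s, π s ∈ M.amb s}

/-- The value of the policy `π` of nature. -/
def natureValue (M : RobustEval S A) (π : S → A → S → ℝ) (s : S) : ℝ :=
  ∑' t : ℕ, M.γ ^ t *
    ∑ s', ((Matrix.of fun x y => M.natureKernel x (π x) y : Matrix S S ℝ) ^ t) s s' *
      M.natureCost s'

/-- The optimal value function of nature. -/
def natureOpt (M : RobustEval S A) (s : S) : ℝ :=
  sInf ((fun π => M.natureValue π s) '' M.policies)

/-! ### Distance generating functions -/

/-- `b` is the (finite) Bregman divergence `f D' - f D - ⟨∇f(D), D' - D⟩`, where the last term is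
the one-sided derivative of `f` at `D` in the direction `D' - D`. At points of the boundary of the
simplex this derivative can be `-∞`; the divergence is then `+∞`, and no real `b` qualifies. -/
def IsBregman (f : (A → S → ℝ) → ℝ) (D D' : A → S → ℝ) (b : ℝ) : Prop :=
  HasDerivWithinAt (fun τ : ℝ => f (D + τ • (D' - D))) (f D' - f D - b) (Ici 0) 0

/-- A family `f s` of distance generating functions with values in `[0, wbar]` whose Bregman
divergences dominate `μw / 2 * ∑ a, ϑ(a|s) ‖D a - D' a‖₁²`. -/
structure IsDGF (M : RobustEval S A) (f : S → (A → S → ℝ) → ℝ) (wbar μw : ℝ) : Prop where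
  wbar_pos : 0 < wbar
  μw_pos : 0 < μw
  convex : ∀ s, ConvexOn ℝ (kernelSimplex S A) (f s)
  nonneg : ∀ s, ∀ D ∈ kernelSimplex S A, 0 ≤ f s D
  le_wbar : ∀ s, ∀ D ∈ kernelSimplex S A, f s D ≤ wbar
  bregman : ∀ s, ∀ D ∈ kernelSimplex S A, ∀ D' ∈ kernelSimplex S A, ∀ b : ℝ,
    IsBregman (f s) D D' b →
      μw / 2 * ∑ a, M.ϑ s a * (∑ s', |D a s' - D' a s'|) ^ 2 ≤ b

/-- The negative entropy weighted by `ϑ(·|s)`, shifted by `log |S|`. -/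
def negEntropy (M : RobustEval S A) (s : S) (D : A → S → ℝ) : ℝ :=
  ∑ a, M.ϑ s a * ∑ s', D a s' * Real.log (D a s') + Real.log (Fintype.card S)

/-! ### The simulator and the simulator-based evaluation (SE) operator -/

/-- `Z t i s` is the sample `(a, s')` drawn at state `s` in step `i` of the SE operator in
iteration `t`: `a ∼ ϑ(·|s)` and `s' ∼ Pbar_{s,a}`, all samples being independent. -/
structure IsSimulator [MeasurableSpace S] [MeasurableSpace A] (M : RobustEval S A)
    {Ω : Type w} [MeasurableSpace Ω] (Pr : Measure Ω) (Z : ℕ → ℕ → S → Ω → A × S) : Prop where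
  measurable : ∀ t i s, Measurable (Z t i s)
  indep : iIndepFun (fun (q : ℕ × ℕ × S) => Z q.1 q.2.1 q.2.2) Pr
  law : ∀ t i s a s', Pr.real {ω | Z t i s ω = (a, s')} = M.ϑ s a * M.Pbar s a s'

/-- The matrix `(1 - ζ) Phat + ζ D^{π,ϑ}`, where `Phat` is the 0-1 matrix of the sampled transitions
`s ↦ x s`. -/
def seMatrix (M : RobustEval S A) (π : S → A → S → ℝ) (x : S → S) : Matrix S S ℝ :=
  Matrix.of fun s s' =>
    (1 - M.ζ) * (if x s = s' then 1 else 0) + M.ζ * ∑ a, M.ϑ s a * π s a s'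

/-- `R_0 = I`, `R_{i+1} = R_i ((1 - ζ) Phat_i + ζ D^{π,ϑ})`. -/
def seR (M : RobustEval S A) (π : S → A → S → ℝ) (x : ℕ → S → S) : ℕ → Matrix S S ℝ
  | 0 => 1
  | i + 1 => seR M π x i * M.seMatrix π (x i)

/-- The SE estimate after `i` steps: `V_0 = R_0 C`, `V_{i+1} = V_i + γ^{i+1} R_{i+1} C`, with `C`
the cost of nature. -/
def seEstimate (M : RobustEval S A) (π : S → A → S → ℝ) (x : ℕ → S → S) : ℕ → S → ℝ
  | 0 => M.natureCost
  | i + 1 => seEstimate M π x i + M.γ ^ (i + 1) • (M.seR π x (i + 1)).mulVec M.natureCost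

/-! ### Stochastic first-order robust policy evaluation (SFRPE) -/

/-- The objective minimized over `D ∈ amb s` in iteration `k` at state `s`, where `V t` is the
estimate obtained in iteration `t`. -/
def updateObjective (M : RobustEval S A) (f : S → (A → S → ℝ) → ℝ) (β lam : ℕ → ℝ)
    (V : ℕ → S → ℝ) (k : ℕ) (s : S) (D : A → S → ℝ) : ℝ :=
  M.γ * M.ζ * ∑ t ∈ Finset.range (k + 1), β t * ∑ a, ∑ s', D a s' * (M.ϑ s a * V t s')
    + lam k * f s D

/-- `π` and `V` are the policies and the estimates of a run of SFRPE with distance generating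
functions `f`, parameters `β, lam`, and the SE operator with `l` steps fed by the samples `Z`.
The initial policy is arbitrary; each policy `π k` is a function of the samples of the
iterations before `k` (so ties between minimizers may be broken in any way). -/
structure IsSFRPERun (M : RobustEval S A) (f : S → (A → S → ℝ) → ℝ) (β lam : ℕ → ℝ) (l : ℕ)
    {Ω : Type w} (Z : ℕ → ℕ → S → Ω → A × S)
    (π : ℕ → Ω → S → A → S → ℝ) (V : ℕ → Ω → S → ℝ) : Prop where
  policy : ∀ k ω, π k ω ∈ M.policies
  adapted : ∀ k ω ω', (∀ t < k, ∀ i < l, ∀ s, Z t i s ω = Z t i s ω') → π k ω = π k ω'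
  evaluate : ∀ k ω, V k ω = M.seEstimate (π k ω) (fun i s => (Z k i s ω).2) l
  update : ∀ k ω s,
    IsMinOn (M.updateObjective f β lam (fun t => V t ω) k s) (M.amb s) (π (k + 1) ω s)

/-- The parameters `β_k = k^{1/2}`. -/
def tunedBeta (k : ℕ) : ℝ := Real.sqrt k

/-- The parameters `λ_k = (k + 1) γ ζ / (2 (1 - γ) √(μw wbar))`. -/
def tunedLam (M : RobustEval S A) (wbar μw : ℝ) (k : ℕ) : ℝ :=
  (k + 1) * M.γ * M.ζ / (2 * (1 - M.γ) * Real.sqrt (μw * wbar))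

/-- The output `∑_{t=1}^k θ_t V_t` with `θ_t = β_t / ∑_{j=1}^k β_j`. -/
def output {Ω : Type w} (β : ℕ → ℝ) (V : ℕ → Ω → S → ℝ) (k : ℕ) (ω : Ω) (s : S) : ℝ :=
  ∑ t ∈ Finset.Icc 1 k, β t / (∑ j ∈ Finset.Icc 1 k, β j) * V t ω s

/-- `X` is an `ε`-estimator of `V` in expectation. -/
def IsEstimator {Ω : Type w} [MeasurableSpace Ω] (Pr : Measure Ω) (X : Ω → S → ℝ) (V : S → ℝ)
    (ε : ℝ) : Prop :=
  ∀ s, Integrable (fun ω => X ω s) Pr ∧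
    -ε ≤ (∫ ω, X ω s ∂Pr) - V s ∧ (∫ ω, X ω s ∂Pr) - V s ≤ ε

/-- The integer part of `1 + 64 γ² ζ² wbar / (μw (1 - γ)^4 ε²)`. -/
def numIter (M : RobustEval S A) (wbar μw ε : ℝ) : ℕ :=
  ⌊1 + 64 * M.γ ^ 2 * M.ζ ^ 2 * wbar / (μw * (1 - M.γ) ^ 4 * ε ^ 2)⌋₊

/-- Indices of all samples drawn in the iterations `0, …, k` of SFRPE with `l` steps of SE. -/
def sampleIndices (S : Type u) [Fintype S] (k l : ℕ) : Finset (ℕ × ℕ × S) :=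
  Finset.range (k + 1) ×ˢ (Finset.range l ×ˢ Finset.univ)

/-- `γ² ζ² |S| wbar L / (μw ε² (1 - γ)^5) + |S| L / (1 - γ)`, where `L` is a logarithmic factor. -/
def sampleBound (M : RobustEval S A) (wbar μw ε L : ℝ) : ℝ :=
  M.γ ^ 2 * M.ζ ^ 2 * Fintype.card S * wbar * L / (μw * ε ^ 2 * (1 - M.γ) ^ 5)
    + Fintype.card S / (1 - M.γ) * L

end RobustEval

end

/-! Policy evaluation becomes online linear optimization at each state, followed by one use of the
Bellman equation.

Nature's transition matrix under `π` is the chain of `ϑ` under the kernel `(1 - ζ) Pbar + ζ π`, and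
its cost is the negated cost of the evaluator. Hence every value of nature is the negative of a
value in the ambiguity set, and the infimum is minus the supremum.

In each step of SE the fresh sampled matrix is independent of the product built so far, so `R_i` has
conditional mean `P_π ^ i`. The estimate is therefore conditionally unbiased for the value truncated
after stage `l`, and it is surely bounded by `1 / (1 - γ)`. As nature's costs are nonpositive,
truncation only increases the value, so the lower error bound is free; the truncated value satisfies
the Bellman equation up to `γ ^ (l + 1)`.

For the upper bound, fix any policy `π'` of nature. The update is dual averaging for the linear
losses `γ ζ ⟨D, V_t⟩` (`IsDGF.dualAveraging_regret`), with a regret bound that holds for every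
realization and at every state. Let `X` be the expected output and `r` the weighted regret bound.
Averaging the approximate Bellman equations and trading `π_t` for `π'` at the price `r` gives `X ≤
cost + γ ^ (l + 1) + r + γ P_{π'} X`. Subtracting the Bellman equation of `π'`, the comparison
principle yields `X - V^{π'} ≤ (γ ^ (l + 1) + r) / (1 - γ)`
(`IsSFRPERun.sum_integral_sub_natureOpt_le`). With the tuned parameters the two terms are at most
`(1 - γ) ε / 2` and `3 (1 - γ) ε / 8`. -/

namespace RobustEval

/-! ### Row-stochastic matrices and the comparison principle -/

section Stochastic

variable {S : Type*} [Fintype S] [DecidableEq S]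

open Matrix

theorem mulVec_le_of_mem_rowStochastic {P : Matrix S S ℝ} (hP : P ∈ rowStochastic ℝ S)
    {v : S → ℝ} {d : ℝ} (hv : ∀ s, v s ≤ d) (s : S) : (P *ᵥ v) s ≤ d :=
  calc (P *ᵥ v) s = ∑ s', P s s' * v s' := rfl
    _ ≤ ∑ s', P s s' * d := Finset.sum_le_sum fun s' _ =>
        mul_le_mul_of_nonneg_left (hv s') (nonneg_of_mem_rowStochastic hP)
    _ = d := by rw [← Finset.sum_mul, sum_row_of_mem_rowStochastic hP, one_mul]

theorem le_mulVec_of_mem_rowStochastic {P : Matrix S S ℝ} (hP : P ∈ rowStochastic ℝ S)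
    {v : S → ℝ} {d : ℝ} (hv : ∀ s, d ≤ v s) (s : S) : d ≤ (P *ᵥ v) s := by
  have h := mulVec_le_of_mem_rowStochastic hP (v := -v) (d := -d)
    (fun s => neg_le_neg (hv s)) s
  rw [mulVec_neg] at h
  exact neg_le_neg_iff.1 h

/-- Comparison principle for the discounted operator `I - γ P`. -/
theorem le_div_of_sub_mulVec_le {P : Matrix S S ℝ} (hP : P ∈ rowStochastic ℝ S) {γ c : ℝ}
    (h0 : 0 ≤ γ) (h1 : γ < 1) {x : S → ℝ} (hx : ∀ s, x s - γ * (P *ᵥ x) s ≤ c) (s : S) :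
    x s ≤ c / (1 - γ) := by
  -- At a maximizer `m` of `x` the average `(P x) m` is at most `x m`, so `(1 - γ) x m ≤ c`.
  obtain ⟨m, -, hm⟩ := Finset.exists_max_image Finset.univ x ⟨s, Finset.mem_univ s⟩
  have h2 : (P *ᵥ x) m ≤ x m :=
    mulVec_le_of_mem_rowStochastic hP (fun s' => hm s' (Finset.mem_univ _)) m
  have h3 := mul_le_mul_of_nonneg_left h2 h0
  rw [le_div_iff₀ (by linarith)]
  have h4 := mul_le_mul_of_nonneg_right (hm s (Finset.mem_univ s)) (show 0 ≤ 1 - γ by linarith)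
  linarith [hx m]

end Stochastic

/-! ### Nature's decision process: values, truncation, duality with the robust value -/

variable {S : Type u} {A : Type v} [Fintype S] [Fintype A]

theorem policies_mem_kernelSimplex (M : RobustEval S A) {π : S → A → S → ℝ}
    (hπ : π ∈ M.policies) (s : S) (a : A) : π s a ∈ stdSimplex ℝ S :=
  M.amb_subset s (hπ s) a

theorem natureCost_mem (M : RobustEval S A) (s : S) : M.natureCost s ∈ Icc (-1 : ℝ) 0 := by
  have h1 : ∑ a, M.ϑ s a * M.cost s a ≤ ∑ a, M.ϑ s a :=
    Finset.sum_le_sum fun a _ =>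
      mul_le_of_le_one_right ((M.ϑ_mem s).1 a) (M.cost_mem s a).2
  have h2 : 0 ≤ ∑ a, M.ϑ s a * M.cost s a :=
    Finset.sum_nonneg fun a _ => mul_nonneg ((M.ϑ_mem s).1 a) (M.cost_mem s a).1
  rw [(M.ϑ_mem s).2] at h1
  simp only [natureCost, mem_Icc]
  constructor <;> linarith

theorem policies_nonempty (M : RobustEval S A) : M.policies.Nonempty :=
  ⟨fun s => (M.amb_nonempty s).choose, fun s => (M.amb_nonempty s).choose_spec⟩

/-- Transition matrix of the states under nature's policy `π`. -/
noncomputable def natureMatrix (M : RobustEval S A) (π : S → A → S → ℝ) : Matrix S S ℝ :=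
  Matrix.of fun x y => M.natureKernel x (π x) y

theorem natureMatrix_apply (M : RobustEval S A) (π : S → A → S → ℝ) (s s' : S) :
    M.natureMatrix π s s' =
      (1 - M.ζ) * ∑ a, M.ϑ s a * M.Pbar s a s' + M.ζ * ∑ a, M.ϑ s a * π s a s' := by
  rw [Finset.mul_sum, Finset.mul_sum, ← Finset.sum_add_distrib]
  exact Finset.sum_congr rfl fun a _ => by ring

variable [DecidableEq S]

open Matrix

/-- The costs of the first `l + 1` stages under nature's policy `π`. -/
noncomputable def truncValue (M : RobustEval S A) (π : S → A → S → ℝ) (l : ℕ) (s : S) : ℝ :=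
  ∑ t ∈ Finset.range (l + 1), M.γ ^ t * ((M.natureMatrix π ^ t) *ᵥ M.natureCost) s

theorem natureMatrix_mem (M : RobustEval S A) {π : S → A → S → ℝ} (hπ : π ∈ M.policies) :
    M.natureMatrix π ∈ rowStochastic ℝ S := by
  rw [mem_rowStochastic_iff_sum]
  have hζ := M.ζ_mem
  constructor
  · intro s s'
    refine Finset.sum_nonneg fun a _ => mul_nonneg (add_nonneg (mul_nonneg ?_ ?_)
      (mul_nonneg hζ.1 ((M.policies_mem_kernelSimplex hπ s a).1 s'))) ((M.ϑ_mem s).1 a)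
    · linarith [hζ.2]
    · exact (M.Pbar_mem s a).1 s'
  · intro s
    change ∑ s', ∑ a, ((1 - M.ζ) * M.Pbar s a s' + M.ζ * π s a s') * M.ϑ s a = 1
    rw [Finset.sum_comm]
    refine (Finset.sum_congr rfl fun a _ => ?_).trans (M.ϑ_mem s).2
    rw [← Finset.sum_mul, Finset.sum_add_distrib, ← Finset.mul_sum, ← Finset.mul_sum,
      (M.Pbar_mem s a).2, (M.policies_mem_kernelSimplex hπ s a).2]
    ring

theorem mulVec_natureCost_mem (M : RobustEval S A) {P : Matrix S S ℝ}
    (hP : P ∈ rowStochastic ℝ S) (s : S) : (P *ᵥ M.natureCost) s ∈ Icc (-1 : ℝ) 0 :=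
  ⟨le_mulVec_of_mem_rowStochastic hP (fun s => (M.natureCost_mem s).1) s,
    mulVec_le_of_mem_rowStochastic hP (fun s => (M.natureCost_mem s).2) s⟩

theorem stage_mem (M : RobustEval S A) {π : S → A → S → ℝ} (hπ : π ∈ M.policies) (t : ℕ) (s : S) :
    M.γ ^ t * ((M.natureMatrix π ^ t) *ᵥ M.natureCost) s ∈ Icc (-M.γ ^ t) 0 := by
  have h := M.mulVec_natureCost_mem (pow_mem (M.natureMatrix_mem hπ) t) s
  have h0 := pow_nonneg M.γ_nonneg t
  constructor
  · nlinarith [h.1]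
  · exact mul_nonpos_of_nonneg_of_nonpos h0 h.2

theorem summable_stage (M : RobustEval S A) {π : S → A → S → ℝ} (hπ : π ∈ M.policies) (s : S) :
    Summable fun t => M.γ ^ t * ((M.natureMatrix π ^ t) *ᵥ M.natureCost) s := by
  refine Summable.of_norm_bounded (summable_geometric_of_lt_one M.γ_nonneg M.γ_lt_one)
    fun t => ?_
  have h := M.stage_mem hπ t s
  rw [Real.norm_eq_abs, abs_le]
  exact ⟨h.1, h.2.trans (pow_nonneg M.γ_nonneg t)⟩

theorem natureValue_eq_tsum (M : RobustEval S A) (π : S → A → S → ℝ) (s : S) :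
    M.natureValue π s = ∑' t, M.γ ^ t * ((M.natureMatrix π ^ t) *ᵥ M.natureCost) s := rfl

theorem mulVec_sum_stage (M : RobustEval S A) (π : S → A → S → ℝ) (t : ℕ) (s : S) :
    M.γ ^ (t + 1) * ((M.natureMatrix π ^ (t + 1)) *ᵥ M.natureCost) s =
      M.γ * ∑ s', M.natureMatrix π s s' *
        (M.γ ^ t * ((M.natureMatrix π ^ t) *ᵥ M.natureCost) s') := by
  rw [pow_succ' (M.natureMatrix π), ← mulVec_mulVec, pow_succ', mul_assoc]
  congr 1
  rw [mulVec, dotProduct, Finset.mul_sum]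
  exact Finset.sum_congr rfl fun s' _ => by ring

/-- The Bellman equation of a policy of nature. -/
theorem natureValue_eq (M : RobustEval S A) {π : S → A → S → ℝ} (hπ : π ∈ M.policies) (s : S) :
    M.natureValue π s =
      M.natureCost s + M.γ * (M.natureMatrix π *ᵥ M.natureValue π) s := by
  rw [natureValue_eq_tsum, (M.summable_stage hπ s).tsum_eq_zero_add]
  simp only [mulVec_sum_stage]
  rw [tsum_mul_left, Summable.tsum_finsetSum
    (fun s' _ => (M.summable_stage hπ s').mul_left _)]
  simp only [tsum_mul_left, pow_zero, one_mul, one_mulVec]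
  rfl

theorem truncValue_succ (M : RobustEval S A) (π : S → A → S → ℝ) (l : ℕ) (s : S) :
    M.truncValue π (l + 1) s =
      M.natureCost s + M.γ * (M.natureMatrix π *ᵥ M.truncValue π l) s := by
  rw [truncValue, Finset.sum_range_succ']
  simp only [mulVec_sum_stage, pow_zero, one_mul, one_mulVec]
  rw [← Finset.mul_sum, Finset.sum_comm, add_comm]
  simp only [mulVec, dotProduct, truncValue, Finset.mul_sum]

/-- Prepending a stage adds the stage cost of index `l + 1`, which is at least `-γ ^ (l + 1)`;
dropping it costs at most that much. -/
theorem truncValue_le (M : RobustEval S A) {π : S → A → S → ℝ} (hπ : π ∈ M.policies) (l : ℕ)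
    (s : S) :
    M.truncValue π l s ≤
      M.natureCost s + M.γ ^ (l + 1) + M.γ * (M.natureMatrix π *ᵥ M.truncValue π l) s := by
  have h := M.truncValue_succ π l s
  rw [truncValue, Finset.sum_range_succ] at h
  have h2 := (M.stage_mem hπ (l + 1) s).1
  simp only [truncValue] at h ⊢
  linarith

/-- The discarded tail consists of nonpositive costs. This makes the lower half of the estimator
property hold for every `l`. -/
theorem natureValue_le_truncValue (M : RobustEval S A) {π : S → A → S → ℝ} (hπ : π ∈ M.policies)
    (l : ℕ) (s : S) : M.natureValue π s ≤ M.truncValue π l s := by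
  have h := (M.summable_stage hπ s).neg.sum_le_tsum (Finset.range (l + 1))
    (fun t _ => neg_nonneg.2 (M.stage_mem hπ t s).2)
  rw [tsum_neg, Finset.sum_neg_distrib] at h
  rw [natureValue_eq_tsum, truncValue]
  linarith

theorem neg_le_natureValue (M : RobustEval S A) {π : S → A → S → ℝ} (hπ : π ∈ M.policies)
    (s : S) : -(1 - M.γ)⁻¹ ≤ M.natureValue π s := by
  have h := (summable_geometric_of_lt_one M.γ_nonneg M.γ_lt_one).neg.tsum_le_tsum
    (fun t => (M.stage_mem hπ t s).1) (M.summable_stage hπ s)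
  rwa [tsum_neg, tsum_geometric_of_lt_one M.γ_nonneg M.γ_lt_one, ← natureValue_eq_tsum] at h

theorem natureOpt_le (M : RobustEval S A) {π : S → A → S → ℝ} (hπ : π ∈ M.policies) (s : S) :
    M.natureOpt s ≤ M.natureValue π s := by
  refine csInf_le ⟨-(1 - M.γ)⁻¹, ?_⟩ (mem_image_of_mem _ hπ)
  rintro _ ⟨π', hπ', rfl⟩
  exact M.neg_le_natureValue hπ' s

theorem le_natureOpt (M : RobustEval S A) {x : ℝ} {s : S}
    (h : ∀ π ∈ M.policies, x ≤ M.natureValue π s) : x ≤ M.natureOpt s := by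
  refine le_csInf (M.policies_nonempty.image _) ?_
  rintro _ ⟨π, hπ, rfl⟩
  exact h π hπ

theorem natureValue_eq_neg_value (M : RobustEval S A) {π P : S → A → S → ℝ}
    (h : ∀ s, P s = (1 - M.ζ) • M.Pbar s + M.ζ • π s) (s : S) :
    M.natureValue π s = -M.value P s := by
  have hP : M.natureMatrix π = M.chain P := by
    ext x y
    refine Finset.sum_congr rfl fun a _ => ?_
    rw [h x]
    simp [mul_comm]
  rw [natureValue_eq_tsum, hP, value, ← tsum_neg]
  refine tsum_congr fun t => ?_
  rw [← mul_neg, ← Finset.sum_neg_distrib]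
  simp only [mulVec, dotProduct, natureCost, mul_neg]

/-- The optimal value of nature is the negative of the robust value. -/
theorem natureOpt_eq_neg_robustValue (M : RobustEval S A) (s : S) :
    M.natureOpt s = -M.robustValue s := by
  -- For real numbers this identity needs no boundedness, so it remains to compare the two sets of
  -- values.
  rw [natureOpt, robustValue, ← Real.sInf_neg]
  congr 1
  ext x
  simp only [mem_image, Set.mem_neg]
  constructor
  · rintro ⟨π, hπ, rfl⟩
    refine ⟨fun s => (1 - M.ζ) • M.Pbar s + M.ζ • π s, fun s => ⟨π s, hπ s, rfl⟩, ?_⟩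
    rw [M.natureValue_eq_neg_value (fun _ => rfl), neg_neg]
  · rintro ⟨P, hP, hx⟩
    choose π hπ hPπ using hP
    exact ⟨π, hπ, by rw [M.natureValue_eq_neg_value hPπ, hx, neg_neg]⟩

end RobustEval

/-! ### Functions of finitely many discrete samples -/

namespace RobustEval

section DependsOn

variable {Ω ι E : Type*}

/-- The function `g` depends only on the samples `Z q` with `q ∈ I`. -/
def DependsOnSamples {β : Type*} (Z : ι → Ω → E) (I : Set ι) (g : Ω → β) : Prop :=
  ∀ ω ω', (∀ q ∈ I, Z q ω = Z q ω') → g ω = g ω'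

/-- Finitely many samples with finitely many values leave a finite domain for `G`, where every
function is measurable and bounded. Policies with arbitrary tie-breaking thus need no measurability
assumption. -/
theorem DependsOnSamples.exists_factor {Z : ι → Ω → E} {I : Finset ι} {g : Ω → ℝ}
    (hg : DependsOnSamples Z I g) : ∃ G : (I → E) → ℝ, g = fun ω => G fun i => Z i ω := by
  have h : g.FactorsThrough fun ω (i : I) => Z i ω := fun ω ω' h =>
    hg ω ω' fun q hq => congrFun h ⟨q, hq⟩
  exact ⟨Function.extend _ g 0, funext fun ω => (h.extend_apply 0 ω).symm⟩

variable [MeasurableSpace Ω] [MeasurableSpace E] [MeasurableSingletonClass E] [Finite E]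
  {Pr : Measure Ω}

theorem DependsOnSamples.integrable [IsFiniteMeasure Pr] {Z : ι → Ω → E} (hZ : ∀ q, Measurable (Z q)) {I : Finset ι}
    {g : Ω → ℝ} (hg : DependsOnSamples Z I g) : Integrable g Pr := by
  obtain ⟨G, rfl⟩ := hg.exists_factor
  have hm : Measurable fun ω => G fun i : I => Z i ω :=
    (Measurable.of_discrete (f := G)).comp (measurable_pi_lambda _ fun i => hZ i)
  obtain ⟨C, hC⟩ := (Set.finite_range fun x => ‖G x‖).bddAbove
  exact Integrable.of_bound hm.aestronglyMeasurable C
    (Filter.Eventually.of_forall fun ω => hC (mem_range_self _))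

theorem DependsOnSamples.integral_mul {Z : ι → Ω → E} (hZ : ∀ q, Measurable (Z q))
    (hind : iIndepFun Z Pr) {I : Finset ι} {g : Ω → ℝ} (hg : DependsOnSamples Z I g) {q : ι}
    (hq : q ∉ I) (φ : E → ℝ) :
    ∫ ω, g ω * φ (Z q ω) ∂Pr = (∫ ω, g ω ∂Pr) * ∫ ω, φ (Z q ω) ∂Pr := by
  obtain ⟨G, rfl⟩ := hg.exists_factor
  have h := (hind.indepFun_finset I {q} (Finset.disjoint_singleton_right.2 hq) hZ).comp
    (Measurable.of_discrete (f := G))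
    (Measurable.of_discrete (f := fun y : ({q} : Finset ι) → E =>
      φ (y ⟨q, Finset.mem_singleton_self q⟩)))
  refine h.integral_fun_mul_eq_mul_integral ?_ ?_
  · exact ((Measurable.of_discrete (f := G)).comp
      (measurable_pi_lambda _ fun i => hZ i)).aestronglyMeasurable
  · exact ((Measurable.of_discrete (f := φ)).comp (hZ q)).aestronglyMeasurable

end DependsOn

/-! ### The SE operator: sure bound and conditional unbiasedness -/

variable {S : Type u} {A : Type v} [Fintype S] [DecidableEq S] [Fintype A]

open Matrix

theorem seEstimate_eq_sum (M : RobustEval S A) (π : S → A → S → ℝ) (x : ℕ → S → S) (l : ℕ)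
    (s : S) :
    M.seEstimate π x l s =
      ∑ i ∈ Finset.range (l + 1), M.γ ^ i * (M.seR π x i *ᵥ M.natureCost) s := by
  induction l with
  | zero => simp [seEstimate, seR]
  | succ l ih => rw [Finset.sum_range_succ, ← ih]; rfl

theorem seMatrix_mem (M : RobustEval S A) {π : S → A → S → ℝ} (hπ : π ∈ M.policies) (x : S → S) :
    M.seMatrix π x ∈ rowStochastic ℝ S := by
  have hζ := M.ζ_mem
  rw [mem_rowStochastic_iff_sum]
  constructor
  · intro s s'
    refine add_nonneg (mul_nonneg (by linarith [hζ.2]) (by split_ifs <;> norm_num))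
      (mul_nonneg hζ.1 (Finset.sum_nonneg fun a _ => mul_nonneg ((M.ϑ_mem s).1 a)
        ((M.policies_mem_kernelSimplex hπ s a).1 s')))
  · intro s
    change ∑ s', ((1 - M.ζ) * (if x s = s' then (1 : ℝ) else 0) +
      M.ζ * ∑ a, M.ϑ s a * π s a s') = 1
    rw [Finset.sum_add_distrib, ← Finset.mul_sum, ← Finset.mul_sum, Finset.sum_comm]
    simp_rw [← Finset.mul_sum, (M.policies_mem_kernelSimplex hπ s _).2]
    simp [(M.ϑ_mem s).2]

theorem seR_mem (M : RobustEval S A) {π : S → A → S → ℝ} (hπ : π ∈ M.policies)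
    (x : ℕ → S → S) (i : ℕ) : M.seR π x i ∈ rowStochastic ℝ S := by
  induction i with
  | zero => exact one_mem _
  | succ i ih => exact mul_mem ih (M.seMatrix_mem hπ _)

/-- Whatever the samples, each `R_i` is stochastic and the costs lie in `[-1, 0]`, so a geometric
series dominates. This sure bound serves as the gradient bound in the regret analysis. -/
theorem abs_seEstimate_le (M : RobustEval S A) {π : S → A → S → ℝ} (hπ : π ∈ M.policies)
    (x : ℕ → S → S) (l : ℕ) (s : S) : |M.seEstimate π x l s| ≤ (1 - M.γ)⁻¹ := by
  rw [seEstimate_eq_sum]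
  calc _ ≤ ∑ i ∈ Finset.range (l + 1), |M.γ ^ i * (M.seR π x i *ᵥ M.natureCost) s| :=
        Finset.abs_sum_le_sum_abs _ _
    _ ≤ ∑ i ∈ Finset.range (l + 1), M.γ ^ i := Finset.sum_le_sum fun i _ => by
        have h := M.mulVec_natureCost_mem (M.seR_mem hπ x i) s
        rw [abs_mul, abs_of_nonneg (pow_nonneg M.γ_nonneg i)]
        exact mul_le_of_le_one_right (pow_nonneg M.γ_nonneg i)
          (abs_le.2 ⟨h.1, h.2.trans zero_le_one⟩)
    _ ≤ (1 - M.γ)⁻¹ := by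
        rw [← tsum_geometric_of_lt_one M.γ_nonneg M.γ_lt_one]
        exact (summable_geometric_of_lt_one M.γ_nonneg M.γ_lt_one).sum_le_tsum _
          fun i _ => pow_nonneg M.γ_nonneg i

theorem seR_congr (M : RobustEval S A) (π : S → A → S → ℝ) {x y : ℕ → S → S} {i : ℕ}
    (h : ∀ j < i, x j = y j) : M.seR π x i = M.seR π y i := by
  induction i with
  | zero => rfl
  | succ i ih => rw [seR, seR, ih fun j hj => h j (hj.trans i.lt_succ_self), h i i.lt_succ_self]

/-- The samples, as a family indexed by triples. -/
def samples {Ω : Type w} (Z : ℕ → ℕ → S → Ω → A × S) (q : ℕ × ℕ × S) : Ω → A × S :=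
  Z q.1 q.2.1 q.2.2

/-- The indices of the samples drawn in the iterations before `t`, with `l` steps each, and in the
first `i` steps of iteration `t`. -/
def pastIndices (S : Type u) [Fintype S] [DecidableEq S] (t l i : ℕ) : Finset (ℕ × ℕ × S) :=
  Finset.range t ×ˢ (Finset.range l ×ˢ Finset.univ) ∪
    {t} ×ˢ (Finset.range i ×ˢ Finset.univ)

theorem mem_pastIndices {t l i : ℕ} {q : ℕ × ℕ × S} :
    q ∈ pastIndices S t l i ↔ q.1 < t ∧ q.2.1 < l ∨ q.1 = t ∧ q.2.1 < i := by
  simp only [pastIndices, Finset.mem_union, Finset.mem_product, Finset.mem_range,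
    Finset.mem_singleton, Finset.mem_univ, and_true]

section Simulator

variable [MeasurableSpace S] [MeasurableSingletonClass S] [MeasurableSpace A]
  [MeasurableSingletonClass A] {M : RobustEval S A} {Ω : Type w} [MeasurableSpace Ω]
  {Pr : Measure Ω} [IsProbabilityMeasure Pr] {Z : ℕ → ℕ → S → Ω → A × S}

theorem IsSimulator.integral_indicator (hZ : M.IsSimulator Pr Z) (t i : ℕ) (s s' : S) :
    ∫ ω, (if (Z t i s ω).2 = s' then (1 : ℝ) else 0) ∂Pr = ∑ a, M.ϑ s a * M.Pbar s a s' := by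
  have h : (fun ω => if (Z t i s ω).2 = s' then (1 : ℝ) else 0) =
      fun ω => ∑ a, {ω | Z t i s ω = (a, s')}.indicator (1 : Ω → ℝ) ω := by
    classical
    funext ω
    by_cases hs : (Z t i s ω).2 = s' <;> simp [hs, indicator, Prod.ext_iff]
  have hm : ∀ a, MeasurableSet {ω | Z t i s ω = (a, s')} := fun a =>
    hZ.measurable t i s (measurableSet_singleton (a, s'))
  rw [h, integral_finsetSum _ fun a _ => (integrable_const 1).indicator (f := (1 : Ω → ℝ)) (hm a)]
  exact Finset.sum_congr rfl fun a _ => by rw [integral_indicator_one (hm a), hZ.law]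

/-- The matrices `R_i` of the SE operator have conditional expectations `P_π ^ i`. -/
theorem IsSimulator.integral_mul_seR (hZ : M.IsSimulator Pr Z) {t l : ℕ}
    {π : Ω → S → A → S → ℝ} (hπ : DependsOnSamples (samples Z) (pastIndices S t l 0) π)
    (i : ℕ) {H : Ω → ℝ} (hH : DependsOnSamples (samples Z) (pastIndices S t l 0) H) (s s'' : S) :
    ∫ ω, H ω * M.seR (π ω) (fun i s => (Z t i s ω).2) i s s'' ∂Pr =
      ∫ ω, H ω * (M.natureMatrix (π ω) ^ i) s s'' ∂Pr := by
  -- Testing against every weight `H` determined by the past replaces conditional expectations. `H`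
  -- must vary because the induction step enlarges it.
  induction i generalizing H s'' with
  | zero => rfl
  | succ i ih =>
    set R : Ω → Matrix S S ℝ := fun ω => M.seR (π ω) (fun i s => (Z t i s ω).2) i with hR
    have hmeas : ∀ q, Measurable (samples Z q) := fun q => hZ.measurable _ _ _
    have hsub : ∀ {ω ω'}, (∀ q ∈ pastIndices S t l i, samples Z q ω = samples Z q ω') →
        ∀ q ∈ pastIndices S t l 0, samples Z q ω = samples Z q ω' := fun h q hq =>
      h q (by rw [mem_pastIndices] at hq ⊢; omega)
    have hRdep : DependsOnSamples (samples Z) (pastIndices S t l i) R := fun ω ω' h => by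
      rw [hR]
      simp only [hπ ω ω' (hsub h)]
      refine M.seR_congr _ fun j hj => funext fun s => ?_
      have := h (t, j, s) (by simp [mem_pastIndices, hj])
      exact congrArg Prod.snd this
    have hHR : ∀ s', DependsOnSamples (samples Z) (pastIndices S t l i)
        fun ω => H ω * R ω s s' := fun s' ω ω' h => by
      simp only [hRdep ω ω' h, hH ω ω' (hsub h)]
    have hHD : ∀ s', DependsOnSamples (samples Z) (pastIndices S t l 0)
        fun ω => H ω * M.natureMatrix (π ω) s' s'' := fun s' ω ω' h => by
      simp only [hπ ω ω' h, hH ω ω' h]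
    have hHRD : ∀ s', DependsOnSamples (samples Z) (pastIndices S t l i)
        fun ω => H ω * R ω s s' * (M.ζ * ∑ a, M.ϑ s' a * π ω s' a s'') := fun s' ω ω' h => by
      simp only [hRdep ω ω' h, hH ω ω' (hsub h), hπ ω ω' (hsub h)]
    have hHRI : ∀ s', DependsOnSamples (samples Z) (pastIndices S t l (i + 1))
        fun ω => H ω * R ω s s' * (if (Z t i s' ω).2 = s'' then (1 : ℝ) else 0) :=
      fun s' ω ω' h => by
        have h1 : Z t i s' ω = Z t i s' ω' := h (t, i, s') (by simp [mem_pastIndices])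
        have h2 : ∀ q ∈ pastIndices S t l i, samples Z q ω = samples Z q ω' := fun q hq =>
          h q (by rw [SetLike.mem_coe, mem_pastIndices] at *; omega)
        simp only [hRdep ω ω' h2, hH ω ω' (hsub h2), h1]
    have hHRP : ∀ s', DependsOnSamples (samples Z) (pastIndices S t l i)
        fun ω => H ω * R ω s s' * M.natureMatrix (π ω) s' s'' := fun s' ω ω' h => by
      simp only [hRdep ω ω' h, hH ω ω' (hsub h), hπ ω ω' (hsub h)]
    have hHPP : ∀ s', DependsOnSamples (samples Z) (pastIndices S t l 0)
        fun ω => H ω * M.natureMatrix (π ω) s' s'' * (M.natureMatrix (π ω) ^ i) s s' :=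
      fun s' ω ω' h => by simp only [hH ω ω' h, hπ ω ω' h]
    -- Row `s'` of the new factor uses only the sample `(t, i, s')`, which is independent of `H`,
    -- `π` and `R`; it may be replaced by its mean.
    have key : ∀ s', ∫ ω, H ω * R ω s s' * M.seMatrix (π ω) (fun s => (Z t i s ω).2) s' s'' ∂Pr =
        ∫ ω, H ω * R ω s s' * M.natureMatrix (π ω) s' s'' ∂Pr := fun s' => by
      have hind := (hHR s').integral_mul (Pr := Pr) hmeas hZ.indep (q := (t, i, s'))
        (by simp [mem_pastIndices]) (fun y => if y.2 = s'' then (1 : ℝ) else 0)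
      have e1 : ∀ ω, H ω * R ω s s' * M.seMatrix (π ω) (fun s => (Z t i s ω).2) s' s'' =
          (1 - M.ζ) * (H ω * R ω s s' * (if (Z t i s' ω).2 = s'' then (1 : ℝ) else 0)) +
            H ω * R ω s s' * (M.ζ * ∑ a, M.ϑ s' a * π ω s' a s'') := fun ω => by
        simp only [seMatrix, of_apply]; ring
      have e2 : ∀ ω, H ω * R ω s s' * M.natureMatrix (π ω) s' s'' =
          (1 - M.ζ) * (H ω * R ω s s' * ∑ a, M.ϑ s' a * M.Pbar s' a s'') +
            H ω * R ω s s' * (M.ζ * ∑ a, M.ϑ s' a * π ω s' a s'') := fun ω => by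
        rw [natureMatrix_apply]; ring
      simp_rw [e1, e2]
      rw [integral_add (((hHRI s').integrable hmeas).const_mul _) ((hHRD s').integrable hmeas),
        integral_add ((((hHR s').integrable hmeas).mul_const _).const_mul _)
          ((hHRD s').integrable hmeas), integral_const_mul, integral_const_mul, integral_mul_const,
        ← hZ.integral_indicator t i]
      exact congrArg (fun y => (1 - M.ζ) * y + _) hind
    have hHRM : ∀ s', Integrable
        (fun ω => H ω * R ω s s' * M.seMatrix (π ω) (fun s => (Z t i s ω).2) s' s'') Pr :=
      fun s' => by
        refine DependsOnSamples.integrable (Z := samples Z) (I := pastIndices S t l (i + 1)) hmeas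
          fun ω ω' h => ?_
        have h1 : Z t i s' ω = Z t i s' ω' := h (t, i, s') (by simp [mem_pastIndices])
        have h2 : ∀ q ∈ pastIndices S t l i, samples Z q ω = samples Z q ω' := fun q hq =>
          h q (by rw [SetLike.mem_coe, mem_pastIndices] at *; omega)
        simp only [seMatrix, of_apply, hRdep ω ω' h2, hH ω ω' (hsub h2), h1, hπ ω ω' (hsub h2)]
    have e3 : ∀ ω, H ω * M.seR (π ω) (fun i s => (Z t i s ω).2) (i + 1) s s'' =
        ∑ s', H ω * R ω s s' * M.seMatrix (π ω) (fun s => (Z t i s ω).2) s' s'' := fun ω => by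
      rw [seR, mul_apply, Finset.mul_sum]
      exact Finset.sum_congr rfl fun s' _ => by rw [mul_assoc]
    have e4 : ∀ ω, H ω * (M.natureMatrix (π ω) ^ (i + 1)) s s'' =
        ∑ s', H ω * M.natureMatrix (π ω) s' s'' * (M.natureMatrix (π ω) ^ i) s s' := fun ω => by
      rw [pow_succ, mul_apply, Finset.mul_sum]
      exact Finset.sum_congr rfl fun s' _ => by ring
    simp_rw [e3, e4]
    rw [integral_finsetSum _ fun s' _ => hHRM s',
      integral_finsetSum _ fun s' _ => (hHPP s').integrable hmeas]
    refine Finset.sum_congr rfl fun s' _ => ?_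
    -- After the replacement the last factor depends only on the past before iteration `t` and is
    -- absorbed into the weight.
    rw [key, ← ih (hHD s')]
    exact integral_congr_ae (Filter.Eventually.of_forall fun ω => by simp only [hR]; ring)

/-- The SE estimate is, conditionally on the past, an unbiased estimate of the truncated value. -/
theorem IsSimulator.integral_mul_seEstimate (hZ : M.IsSimulator Pr Z) {t l : ℕ}
    {π : Ω → S → A → S → ℝ} (hπ : DependsOnSamples (samples Z) (pastIndices S t l 0) π)
    {H : Ω → ℝ} (hH : DependsOnSamples (samples Z) (pastIndices S t l 0) H) (s : S) :
    ∫ ω, H ω * M.seEstimate (π ω) (fun i s => (Z t i s ω).2) l s ∂Pr =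
      ∫ ω, H ω * M.truncValue (π ω) l s ∂Pr := by
  have hmeas : ∀ q, Measurable (samples Z q) := fun q => hZ.measurable _ _ _
  have e1 : ∀ ω, H ω * M.seEstimate (π ω) (fun i s => (Z t i s ω).2) l s =
      ∑ i ∈ Finset.range (l + 1), ∑ s', M.γ ^ i * M.natureCost s' *
        (H ω * M.seR (π ω) (fun i s => (Z t i s ω).2) i s s') := fun ω => by
    simp only [seEstimate_eq_sum, mulVec, dotProduct, Finset.mul_sum]
    exact Finset.sum_congr rfl fun i _ => Finset.sum_congr rfl fun s' _ => by ring
  have e2 : ∀ ω, H ω * M.truncValue (π ω) l s =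
      ∑ i ∈ Finset.range (l + 1), ∑ s', M.γ ^ i * M.natureCost s' *
        (H ω * (M.natureMatrix (π ω) ^ i) s s') := fun ω => by
    simp only [truncValue, mulVec, dotProduct, Finset.mul_sum]
    exact Finset.sum_congr rfl fun i _ => Finset.sum_congr rfl fun s' _ => by ring
  have i1 : ∀ i s', Integrable
      (fun ω => H ω * M.seR (π ω) (fun i s => (Z t i s ω).2) i s s') Pr := fun i s' => by
    refine DependsOnSamples.integrable (Z := samples Z) (I := pastIndices S t l i) hmeas
      fun ω ω' h => ?_
    have h2 : ∀ q ∈ pastIndices S t l 0, samples Z q ω = samples Z q ω' := fun q hq =>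
      h q (by rw [SetLike.mem_coe, mem_pastIndices] at *; omega)
    have h3 : M.seR (π ω') (fun i s => (Z t i s ω).2) i =
        M.seR (π ω') (fun i s => (Z t i s ω').2) i :=
      M.seR_congr _ fun j hj => funext fun s =>
        congrArg Prod.snd (h (t, j, s) (by simp [mem_pastIndices, hj]))
    simp only [hπ ω ω' h2, hH ω ω' h2, h3]
  have i2 : ∀ i s', Integrable (fun ω => H ω * (M.natureMatrix (π ω) ^ i) s s') Pr :=
    fun i s' => DependsOnSamples.integrable (Z := samples Z) (I := pastIndices S t l 0) hmeas
      fun ω ω' h => by simp only [hπ ω ω' h, hH ω ω' h]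
  simp_rw [e1, e2]
  rw [integral_finsetSum _ fun i _ => integrable_finsetSum _ fun s' _ => (i1 i s').const_mul _,
    integral_finsetSum _ fun i _ => integrable_finsetSum _ fun s' _ => (i2 i s').const_mul _]
  refine Finset.sum_congr rfl fun i _ => ?_
  rw [integral_finsetSum _ fun s' _ => (i1 i s').const_mul _,
    integral_finsetSum _ fun s' _ => (i2 i s').const_mul _]
  refine Finset.sum_congr rfl fun s' _ => ?_
  rw [integral_const_mul, integral_const_mul, hZ.integral_mul_seR hπ i hH]

end Simulator

end RobustEval

/-! ### Dual averaging with Bregman divergences -/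

/-- A convex function on `[0, 1]` whose slopes at `0` are bounded below by `m` has a right
derivative at `0`, and this derivative is at least `m`. -/
theorem ConvexOn.exists_hasDerivWithinAt_Ici_zero {φ : ℝ → ℝ} (hφ : ConvexOn ℝ (Icc 0 1) φ)
    {m : ℝ} (hm : ∀ τ ∈ Ioc (0 : ℝ) 1, φ 0 + τ * m ≤ φ τ) :
    ∃ d, m ≤ d ∧ HasDerivWithinAt φ d (Ici 0) 0 := by
  have hbd : ∀ τ ∈ Ioo (0 : ℝ) 1, m ≤ slope φ 0 τ := fun τ hτ => by
    rw [slope_def_field, sub_zero, le_div_iff₀ hτ.1]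
    linarith [hm τ ⟨hτ.1, hτ.2.le⟩]
  -- Slopes of a convex function increase, so their limit at `0` from the right is their infimum,
  -- finite because of `m`.
  have hmono : MonotoneOn (slope φ 0) (Ioo 0 1) :=
    (hφ.slope_mono (left_mem_Icc.2 zero_le_one)).mono
      fun τ hτ => ⟨⟨hτ.1.le, hτ.2.le⟩, hτ.1.ne'⟩
  refine ⟨sInf (slope φ 0 '' Ioo 0 1), le_csInf ⟨_, mem_image_of_mem _
    (show (1 / 2 : ℝ) ∈ Ioo 0 1 by constructor <;> norm_num)⟩ ?_, ?_⟩
  · rintro _ ⟨τ, hτ, rfl⟩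
    exact hbd τ hτ
  · rw [← hasDerivWithinAt_Ioi_iff_Ici, hasDerivWithinAt_iff_tendsto_slope' self_notMem_Ioi]
    refine hmono.tendsto_nhdsWithin_Ioo_right (nonempty_Ioo.2 zero_lt_one) ⟨m, ?_⟩
    rintro _ ⟨τ, hτ, rfl⟩
    exact hbd τ hτ

namespace RobustEval

variable {S : Type u} {A : Type v} [Fintype S] [Fintype A]

/-- Hölder's inequality between `ℓ¹` and `ℓ^∞` in each row, averaged over `ϑ`. -/
theorem kernelSimplex_sub_le (M : RobustEval S A) (s : S) {v : S → ℝ} {G : ℝ}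
    (hv : ∀ s', |v s'| ≤ G) (D D' : A → S → ℝ) :
    ∑ a, ∑ s', (D a s' - D' a s') * (M.ϑ s a * v s') ≤
      ∑ a, M.ϑ s a * (G * ∑ s', |D a s' - D' a s'|) := by
  refine Finset.sum_le_sum fun a _ => ?_
  rw [Finset.mul_sum, Finset.mul_sum]
  refine Finset.sum_le_sum fun s' _ => ?_
  rw [mul_left_comm]
  refine mul_le_mul_of_nonneg_left ?_ ((M.ϑ_mem s).1 a)
  calc (D a s' - D' a s') * v s' ≤ |D a s' - D' a s'| * |v s'| := by
        rw [← abs_mul]; exact le_abs_self _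
    _ ≤ |D a s' - D' a s'| * G := mul_le_mul_of_nonneg_left (hv s') (abs_nonneg _)
    _ = G * |D a s' - D' a s'| := mul_comm _ _

/-- The linear functional `D ↦ ∑ a s', D_a(s') ϑ(a|s) v(s')`. -/
noncomputable def pairing (M : RobustEval S A) (s : S) (v : S → ℝ) : (A → S → ℝ) →ₗ[ℝ] ℝ where
  toFun D := ∑ a, ∑ s', D a s' * (M.ϑ s a * v s')
  map_add' D D' := by simp only [Pi.add_apply, add_mul, Finset.sum_add_distrib]
  map_smul' c D := by
    simp only [Pi.smul_apply, smul_eq_mul, mul_assoc, Finset.mul_sum, RingHom.id_apply]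

theorem pairing_apply (M : RobustEval S A) (s : S) (v : S → ℝ) (D : A → S → ℝ) :
    M.pairing s v D = ∑ a, ∑ s', D a s' * (M.ϑ s a * v s') := rfl

variable {M : RobustEval S A} {f : S → (A → S → ℝ) → ℝ} {wbar μw : ℝ}

/-- Minimizers of a linear functional plus a multiple of a distance generating function satisfy
the three-point inequality. -/
theorem IsDGF.add_le_of_isMinOn (hf : M.IsDGF f wbar μw) {s : S} {lam : ℝ} (hlam : 0 < lam)
    {L : (A → S → ℝ) →ₗ[ℝ] ℝ} {D D' : A → S → ℝ}
    (hmin : IsMinOn (fun D => L D + lam * f s D) (M.amb s) D) (hD : D ∈ M.amb s)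
    (hD' : D' ∈ M.amb s) :
    L D + lam * f s D + lam * (μw / 2 * ∑ a, M.ϑ s a * (∑ s', |D a s' - D' a s'|) ^ 2) ≤
      L D' + lam * f s D' := by
  have hseg : ∀ τ ∈ Icc (0 : ℝ) 1, D + τ • (D' - D) ∈ M.amb s := fun τ hτ =>
    (M.amb_convex s).add_smul_sub_mem hD hD' hτ
  have hconv : ConvexOn ℝ (Icc 0 1) fun τ : ℝ => f s (D + τ • (D' - D)) := by
    have h := (hf.convex s).comp_affineMap (AffineMap.lineMap D D')
    have h2 := h.subset (fun τ hτ => by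
      rw [mem_preimage, AffineMap.lineMap_apply_module', add_comm]
      exact M.amb_subset s (hseg τ hτ)) (convex_Icc (0 : ℝ) 1)
    refine h2.congr fun τ _ => ?_
    rw [Function.comp_apply, AffineMap.lineMap_apply_module', add_comm]
  -- Minimality along the segment bounds the slopes of `f s` from below. Hence the directional
  -- derivative at a minimizer is finite even on the boundary of the simplex, and the Bregman
  -- condition applies with a real divergence.
  obtain ⟨d, hmd, hd⟩ := hconv.exists_hasDerivWithinAt_Ici_zero (m := -(L (D' - D)) / lam)
    fun τ hτ => by
      have h : L D + lam * f s D ≤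
          L (D + τ • (D' - D)) + lam * f s (D + τ • (D' - D)) := hmin (hseg τ ⟨hτ.1.le, hτ.2⟩)
      rw [map_add, map_smul, smul_eq_mul] at h
      rw [zero_smul, add_zero, ← mul_le_mul_iff_right₀ hlam, mul_add]
      have e : lam * (τ * (-(L (D' - D)) / lam)) = -(τ * L (D' - D)) := by field_simp
      rw [e]
      linarith
  have hb := hf.bregman s D (M.amb_subset s hD) D' (M.amb_subset s hD') (f s D' - f s D - d)
    (by rw [IsBregman, sub_sub_cancel]; exact hd)
  rw [div_le_iff₀ hlam, map_sub] at hmd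
  have := mul_le_mul_of_nonneg_left hb hlam.le
  linarith

/-- Regret of dual averaging. -/
theorem IsDGF.dualAveraging_regret (hf : M.IsDGF f wbar μw) {β lam : ℕ → ℝ} (hβ0 : β 0 = 0)
    (hβ : ∀ k, 0 ≤ β k) (hlam : ∀ k, 0 < lam k) (hmono : Monotone lam) {V : ℕ → S → ℝ} {G : ℝ}
    (hV : ∀ t s, |V t s| ≤ G) {π : ℕ → S → A → S → ℝ} (hπ : ∀ k, π k ∈ M.policies) {s : S}
    (hmin : ∀ k, IsMinOn (M.updateObjective f β lam V k s) (M.amb s) (π (k + 1) s))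
    {D : A → S → ℝ} (hD : D ∈ M.amb s) (k : ℕ) :
    M.γ * M.ζ * ∑ t ∈ Finset.range (k + 1),
        β t * (M.pairing s (V t) (π t s) - M.pairing s (V t) D) ≤
      lam k * wbar +
        ∑ t ∈ Finset.range k, (M.γ * M.ζ * β (t + 1) * G) ^ 2 / (2 * (lam t * μw)) := by
  have hη : 0 ≤ M.γ * M.ζ := mul_nonneg M.γ_nonneg M.ζ_mem.1
  have hobj : ∀ k D, M.updateObjective f β lam V k s D =
      ((M.γ * M.ζ) • ∑ t ∈ Finset.range (k + 1), β t • M.pairing s (V t)) D + lam k * f s D :=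
    fun k D => by
      simp [updateObjective, pairing_apply, LinearMap.sum_apply]
  have hfnn : ∀ k, 0 ≤ f s (π k s) := fun k => hf.nonneg s _ (M.amb_subset s (hπ k s))
  -- Induction on the minimal value of the objective: it dominates the accumulated losses up to the
  -- stability terms. The base case uses `β 0 = 0`, so the arbitrary initial policy incurs no loss.
  have key : M.γ * M.ζ * ∑ t ∈ Finset.range (k + 1), β t * M.pairing s (V t) (π t s) -
      ∑ t ∈ Finset.range k, (M.γ * M.ζ * β (t + 1) * G) ^ 2 / (2 * (lam t * μw)) ≤
      M.updateObjective f β lam V k s (π (k + 1) s) := by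
    induction k with
    | zero =>
      simp only [updateObjective, zero_add, Finset.sum_range_one, Finset.range_zero,
        Finset.sum_empty, hβ0, zero_mul, mul_zero, sub_zero]
      exact mul_nonneg (hlam 0).le (hfnn 1)
    | succ k ih =>
      have h1 := hf.add_le_of_isMinOn (hlam k)
        (L := (M.γ * M.ζ) • ∑ t ∈ Finset.range (k + 1), β t • M.pairing s (V t))
        (by simpa only [← hobj] using hmin k) (hπ (k + 1) s) (hπ (k + 2) s)
      rw [← hobj] at h1
      have h2 : M.updateObjective f β lam V (k + 1) s (π (k + 2) s) =
          ((M.γ * M.ζ) • ∑ t ∈ Finset.range (k + 1), β t • M.pairing s (V t)) (π (k + 2) s) +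
          M.γ * M.ζ * (β (k + 1) * M.pairing s (V (k + 1)) (π (k + 2) s)) +
          lam (k + 1) * f s (π (k + 2) s) := by
        rw [hobj, Finset.sum_range_succ _ (k + 1), smul_add, LinearMap.add_apply]
        simp
      have h3 := mul_le_mul_of_nonneg_right (hmono k.le_succ) (hfnn (k + 2))
      have h4 : M.pairing s (V (k + 1)) (π (k + 1) s) - M.pairing s (V (k + 1)) (π (k + 2) s) ≤
          ∑ a, M.ϑ s a * (G * ∑ s', |π (k + 1) s a s' - π (k + 2) s a s'|) := by
        rw [← map_sub]
        exact M.kernelSimplex_sub_le s (hV (k + 1)) _ _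
      have h5 := mul_le_mul_of_nonneg_left h4 (mul_nonneg hη (hβ (k + 1)))
      have hc : 0 < lam k * μw := mul_pos (hlam k) hf.μw_pos
      -- Young's inequality in each action: the quadratic gain from the three-point inequality
      -- absorbs the movement from `π (k + 1)` to `π (k + 2)`.
      have h6 : M.γ * M.ζ * β (k + 1) *
            ∑ a, M.ϑ s a * (G * ∑ s', |π (k + 1) s a s' - π (k + 2) s a s'|) ≤
          lam k * (μw / 2 *
            ∑ a, M.ϑ s a * (∑ s', |π (k + 1) s a s' - π (k + 2) s a s'|) ^ 2) +
          (M.γ * M.ζ * β (k + 1) * G) ^ 2 / (2 * (lam k * μw)) := by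
        have h7 : (M.γ * M.ζ * β (k + 1) * G) ^ 2 / (2 * (lam k * μw)) =
            ∑ a, M.ϑ s a * ((M.γ * M.ζ * β (k + 1) * G) ^ 2 / (2 * (lam k * μw))) := by
          rw [← Finset.sum_mul, (M.ϑ_mem s).2, one_mul]
        rw [h7, Finset.mul_sum, Finset.mul_sum, Finset.mul_sum, ← Finset.sum_add_distrib]
        refine Finset.sum_le_sum fun a _ => ?_
        set x := ∑ s', |π (k + 1) s a s' - π (k + 2) s a s'|
        have h8 : M.γ * M.ζ * β (k + 1) * G * x ≤ lam k * μw / 2 * x ^ 2 +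
            (M.γ * M.ζ * β (k + 1) * G) ^ 2 / (2 * (lam k * μw)) := by
          rw [← sub_nonneg]
          have e : lam k * μw / 2 * x ^ 2 + (M.γ * M.ζ * β (k + 1) * G) ^ 2 /
              (2 * (lam k * μw)) - M.γ * M.ζ * β (k + 1) * G * x =
              (lam k * μw * x - M.γ * M.ζ * β (k + 1) * G) ^ 2 / (2 * (lam k * μw)) := by
            generalize lam k * μw = c at hc
            field_simp
            ring
          rw [e]
          positivity
        linarith [mul_le_mul_of_nonneg_left h8 ((M.ϑ_mem s).1 a)]
      rw [Finset.sum_range_succ _ (k + 1), Finset.sum_range_succ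
        (fun t => (M.γ * M.ζ * β (t + 1) * G) ^ 2 / (2 * (lam t * μw))) k, h2]
      linarith
  have hle : M.updateObjective f β lam V k s (π (k + 1) s) ≤
      M.updateObjective f β lam V k s D := hmin k hD
  have hD2 : M.updateObjective f β lam V k s D =
      M.γ * M.ζ * ∑ t ∈ Finset.range (k + 1), β t * M.pairing s (V t) D + lam k * f s D := rfl
  have hw := mul_le_mul_of_nonneg_left (hf.le_wbar s D (M.amb_subset s hD)) (hlam k).le
  simp only [mul_sub, Finset.sum_sub_distrib]
  linarith

/-- Regret of dual averaging with the tuned parameters. -/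
theorem IsDGF.tuned_regret (hf : M.IsDGF f wbar μw) {V : ℕ → S → ℝ}
    (hV : ∀ t s, |V t s| ≤ (1 - M.γ)⁻¹) {π : ℕ → S → A → S → ℝ} (hπ : ∀ k, π k ∈ M.policies)
    {s : S}
    (hmin : ∀ k,
      IsMinOn (M.updateObjective f tunedBeta (M.tunedLam wbar μw) V k s) (M.amb s) (π (k + 1) s))
    {D : A → S → ℝ} (hD : D ∈ M.amb s) {k : ℕ} (hk : 1 ≤ k) :
    M.γ * M.ζ * ∑ t ∈ Finset.Icc 1 k,
        tunedBeta t * (M.pairing s (V t) (π t s) - M.pairing s (V t) D) ≤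
      2 * k * (M.γ * M.ζ * Real.sqrt (wbar / μw) / (1 - M.γ)) := by
  have hγ : 0 < 1 - M.γ := sub_pos.2 M.γ_lt_one
  -- If `γ ζ = 0` the parameters `tunedLam` vanish and dual averaging is not available, but both
  -- sides are zero.
  rcases (mul_nonneg M.γ_nonneg M.ζ_mem.1).eq_or_lt with h0 | hη
  · simp [← h0]
  have hw := hf.wbar_pos
  have hμ := hf.μw_pos
  have hr : 0 < Real.sqrt (μw * wbar) := Real.sqrt_pos.2 (mul_pos hμ hw)
  have hlamk : ∀ k : ℕ, M.tunedLam wbar μw k =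
      (k + 1) * (M.γ * M.ζ) / (2 * (1 - M.γ) * Real.sqrt (μw * wbar)) := fun k => by
    rw [tunedLam, mul_assoc]
  have hlam : ∀ k, 0 < M.tunedLam wbar μw k := fun k => by rw [hlamk]; positivity
  have hmono : Monotone (M.tunedLam wbar μw) := fun i j hij => by
    have : (i : ℝ) ≤ j := by exact_mod_cast hij
    rw [hlamk, hlamk]
    gcongr
  have hreg := hf.dualAveraging_regret (β := tunedBeta) (by simp [tunedBeta])
    (fun k => Real.sqrt_nonneg _) hlam hmono hV hπ hmin hD k
  have hsum : ∑ t ∈ Finset.range (k + 1),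
        tunedBeta t * (M.pairing s (V t) (π t s) - M.pairing s (V t) D) =
      ∑ t ∈ Finset.Icc 1 k,
        tunedBeta t * (M.pairing s (V t) (π t s) - M.pairing s (V t) D) := by
    rw [Finset.range_eq_Ico, Finset.sum_eq_sum_Ico_succ_bot (Nat.succ_pos k)]
    simp only [tunedBeta, Nat.cast_zero, Real.sqrt_zero, zero_mul, zero_add]
    rfl
  have hs1 : Real.sqrt (μw * wbar) = μw * Real.sqrt (wbar / μw) := by
    rw [show μw * wbar = μw ^ 2 * (wbar / μw) by field_simp, Real.sqrt_mul (sq_nonneg _),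
      Real.sqrt_sq hμ.le]
  have hq : 0 < Real.sqrt (wbar / μw) := Real.sqrt_pos.2 (div_pos hw hμ)
  have hq2 : wbar = μw * Real.sqrt (wbar / μw) ^ 2 := by
    rw [Real.sq_sqrt (div_pos hw hμ).le]; field_simp
  rw [hsum] at hreg
  refine hreg.trans ?_
  -- Since `tunedBeta (t + 1) ^ 2 = t + 1` cancels the factor `t + 1` of `tunedLam`, all stability
  -- terms are equal. With the regularizer term the total factor is `(k + 1) / 2 + k ≤ 2 k`.
  have hterm : ∀ t ∈ Finset.range k, (M.γ * M.ζ * tunedBeta (t + 1) * (1 - M.γ)⁻¹) ^ 2 /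
      (2 * (M.tunedLam wbar μw t * μw)) =
        M.γ * M.ζ * Real.sqrt (wbar / μw) / (1 - M.γ) := fun t _ => by
    have ht : tunedBeta (t + 1) ^ 2 = (t : ℝ) + 1 := by
      rw [tunedBeta, Real.sq_sqrt (Nat.cast_nonneg _)]; push_cast; rfl
    rw [mul_pow, mul_pow, ht, hlamk, hs1]
    have ht0 : (0 : ℝ) < t + 1 := by positivity
    generalize M.γ * M.ζ = η at hη
    generalize (t : ℝ) + 1 = t' at ht0
    field_simp
  have hfirst : M.tunedLam wbar μw k * wbar =
      (k + 1) / 2 * (M.γ * M.ζ * Real.sqrt (wbar / μw) / (1 - M.γ)) := by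
    rw [hlamk, hs1]
    generalize M.γ * M.ζ = η at hη
    generalize Real.sqrt (wbar / μw) = q at hq hq2
    rw [hq2]
    field_simp
  rw [Finset.sum_congr rfl hterm, hfirst, Finset.sum_const, Finset.card_range, nsmul_eq_mul,
    ← add_mul]
  have hk' : (1 : ℝ) ≤ k := by exact_mod_cast hk
  refine mul_le_mul_of_nonneg_right ?_ (by positivity)
  linarith

end RobustEval

/-! ### The weighted negative entropy as a distance generating function -/

/-- Strong convexity of the negative entropy with respect to the `ℓ¹` norm. -/
theorem sum_mul_log_segment_le {S : Type*} [Fintype S] {p q : S → ℝ}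
    (hp : p ∈ stdSimplex ℝ S) (hq : q ∈ stdSimplex ℝ S) {τ : ℝ} (hτ : τ ∈ Icc (0 : ℝ) 1) :
    ∑ s, (p s + τ * (q s - p s)) * Real.log (p s + τ * (q s - p s)) ≤
      (1 - τ) * ∑ s, p s * Real.log (p s) + τ * ∑ s, q s * Real.log (q s) -
        τ * (1 - τ) / 2 * (∑ s, |p s - q s|) ^ 2 := by
  set Q := (∑ s, |p s - q s|) ^ 2 with hQ
  -- Coordinates with `p s = q s` may vanish identically and are treated as constants below; all
  -- others are positive inside the segment.
  have hpos : ∀ x ∈ Ioo (0 : ℝ) 1, ∀ s, q s - p s ≠ 0 → 0 < p s + x * (q s - p s) := by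
    intro x hx s hs
    have hp0 := hp.1 s
    have hq0 := hq.1 s
    rcases hp0.eq_or_lt with h | h
    · have : 0 < q s := lt_of_le_of_ne hq0 fun h' => hs (by rw [← h, ← h', sub_zero])
      rw [← h]; nlinarith [mul_pos hx.1 this]
    · nlinarith [mul_pos (sub_pos.2 hx.2) h, mul_nonneg hx.1.le hq0]
  -- The claim is convexity, along the segment, of the entropy minus the quadratic `Q / 2 * x ^ 2`,
  -- tested at the endpoints.
  have hconv : ConvexOn ℝ (Icc 0 1) fun x : ℝ =>
      ∑ s, (p s + x * (q s - p s)) * Real.log (p s + x * (q s - p s)) - Q / 2 * x ^ 2 := by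
    have hlin : ∀ s x, HasDerivAt (fun x : ℝ => p s + x * (q s - p s)) (q s - p s) x :=
      fun s x => by
        simpa using ((hasDerivAt_id x).mul_const (q s - p s)).const_add (p s)
    refine convexOn_of_hasDerivWithinAt2_nonneg (convex_Icc 0 1)
      (f' := fun x => ∑ s, (Real.log (p s + x * (q s - p s)) + 1) * (q s - p s) - Q * x)
      (f'' := fun x => ∑ s, (q s - p s) ^ 2 / (p s + x * (q s - p s)) - Q) ?_ ?_ ?_ ?_
    · refine (Continuous.sub (continuous_finsetSum _ fun s _ => ?_) (by fun_prop)).continuousOn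
      exact Real.continuous_mul_log.comp (f := fun x : ℝ => p s + x * (q s - p s)) (by fun_prop)
    · intro x hx
      rw [interior_Icc] at hx ⊢
      refine (HasDerivAt.sub (HasDerivAt.fun_sum fun s _ => ?_) ?_).hasDerivWithinAt
      · by_cases hs : q s - p s = 0
        · simpa [hs] using hasDerivAt_const x (p s * Real.log (p s))
        · exact (Real.hasDerivAt_mul_log (hpos x hx s hs).ne').comp x (hlin s x)
      · exact ((hasDerivAt_pow 2 x).const_mul (Q / 2)).congr_deriv (by norm_num; ring)
    · intro x hx
      rw [interior_Icc] at hx ⊢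
      refine (HasDerivAt.sub (HasDerivAt.fun_sum fun s _ => ?_) ?_).hasDerivWithinAt
      · by_cases hs : q s - p s = 0
        · simpa [hs] using hasDerivAt_const x (0 : ℝ)
        · exact ((((hlin s x).log (hpos x hx s hs).ne').add_const 1).mul_const
            (q s - p s)).congr_deriv (by ring)
      · simpa using (hasDerivAt_id x).const_mul Q
    · intro x hx
      rw [interior_Icc] at hx
      have hm : ∀ s, 0 ≤ p s + x * (q s - p s) := fun s => by
        nlinarith [mul_nonneg (sub_nonneg.2 hx.2.le) (hp.1 s), mul_nonneg hx.1.le (hq.1 s)]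
      have hsum : ∑ s, (p s + x * (q s - p s)) = 1 := by
        rw [Finset.sum_add_distrib, ← Finset.mul_sum, Finset.sum_sub_distrib, hp.2, hq.2]
        ring
      -- Cauchy–Schwarz with weights of total mass one bounds the second derivative of the entropy
      -- below by the squared `ℓ¹` distance.
      have hcs := Finset.sum_sq_le_sum_mul_sum_of_sq_le_mul Finset.univ
        (r := fun s => |p s - q s|)
        (f := fun s => (q s - p s) ^ 2 / (p s + x * (q s - p s)))
        (g := fun s => p s + x * (q s - p s))
        (fun s _ => div_nonneg (sq_nonneg _) (hm s)) (fun s _ => hm s) (fun s _ => le_of_eq (by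
          rw [sq_abs]
          by_cases hs : q s - p s = 0
          · rw [show p s - q s = 0 by linarith, hs]; simp
          · rw [div_mul_cancel₀ _ (hpos x hx s hs).ne']; ring))
      rw [hsum, mul_one] at hcs
      exact sub_nonneg.2 hcs
  have h := hconv.2 (left_mem_Icc.2 zero_le_one) (right_mem_Icc.2 zero_le_one)
    (sub_nonneg.2 hτ.2) hτ.1 (sub_add_cancel 1 τ)
  simp only [smul_eq_mul, mul_zero, mul_one, zero_add, zero_mul, add_zero, one_mul,
    add_sub_cancel] at h
  nlinarith [h]

namespace RobustEval

variable {S : Type u} {A : Type v} [Fintype S] [Fintype A]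

theorem sum_mul_log_nonpos {p : S → ℝ} (hp : p ∈ stdSimplex ℝ S) :
    ∑ s, p s * Real.log (p s) ≤ 0 :=
  Finset.sum_nonpos fun s _ => mul_nonpos_of_nonneg_of_nonpos (hp.1 s)
    (Real.log_nonpos (hp.1 s) (by
      rw [← hp.2]; exact Finset.single_le_sum (fun s _ => hp.1 s) (Finset.mem_univ s)))

/-- Jensen's inequality for `x log x` with uniform weights. -/
theorem neg_log_card_le_sum_mul_log (hS : 0 < Fintype.card S) {p : S → ℝ}
    (hp : p ∈ stdSimplex ℝ S) : -Real.log (Fintype.card S) ≤ ∑ s, p s * Real.log (p s) := by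
  have hc : (0 : ℝ) < Fintype.card S := by exact_mod_cast hS
  have h := Real.convexOn_mul_log.map_sum_le (t := Finset.univ)
    (w := fun _ : S => (Fintype.card S : ℝ)⁻¹) (p := p) (fun _ _ => by positivity)
    (by simp [hc.ne']) (fun s _ => hp.1 s)
  simp only [smul_eq_mul, ← Finset.mul_sum, hp.2, mul_one, Real.log_inv] at h
  exact le_of_mul_le_mul_left h (inv_pos.2 hc)

theorem negEntropy_segment_le (M : RobustEval S A) (s : S) {D D' : A → S → ℝ}
    (hD : D ∈ kernelSimplex S A) (hD' : D' ∈ kernelSimplex S A) {τ : ℝ}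
    (hτ : τ ∈ Icc (0 : ℝ) 1) :
    M.negEntropy s (D + τ • (D' - D)) ≤
      (1 - τ) * M.negEntropy s D + τ * M.negEntropy s D' -
        τ * (1 - τ) / 2 * ∑ a, M.ϑ s a * (∑ s', |D a s' - D' a s'|) ^ 2 := by
  have h : ∑ a, M.ϑ s a * ∑ s', (D + τ • (D' - D)) a s' * Real.log ((D + τ • (D' - D)) a s') ≤
      ∑ a, M.ϑ s a * ((1 - τ) * ∑ s', D a s' * Real.log (D a s') +
        τ * ∑ s', D' a s' * Real.log (D' a s') -
          τ * (1 - τ) / 2 * (∑ s', |D a s' - D' a s'|) ^ 2) :=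
    Finset.sum_le_sum fun a _ => mul_le_mul_of_nonneg_left
      (sum_mul_log_segment_le (hD a) (hD' a) hτ) ((M.ϑ_mem s).1 a)
  simp only [mul_sub, mul_add, mul_left_comm (M.ϑ s _), Finset.sum_sub_distrib,
    Finset.sum_add_distrib, ← Finset.mul_sum] at h
  simp only [negEntropy]
  linarith

/-- The weighted negative entropy is a distance generating function. -/
theorem isDGF_negEntropy (M : RobustEval S A) (hS : 2 ≤ Fintype.card S) :
    M.IsDGF M.negEntropy (Real.log (Fintype.card S)) 1 where
  wbar_pos := Real.log_pos (by exact_mod_cast hS)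
  μw_pos := one_pos
  convex s := by
    refine ⟨fun D hD D' hD' x y hx hy hxy a =>
      convex_stdSimplex ℝ S (hD a) (hD' a) hx hy hxy, fun D hD D' hD' x y hx hy hxy => ?_⟩
    have h := M.negEntropy_segment_le s hD hD' (τ := y) ⟨hy, by linarith⟩
    have e : x • D + y • D' = D + y • (D' - D) := by
      rw [← eq_sub_iff_add_eq] at hxy
      rw [hxy]; module
    have h2 : 0 ≤ y * (1 - y) / 2 * ∑ a, M.ϑ s a * (∑ s', |D a s' - D' a s'|) ^ 2 :=
      mul_nonneg (by have : 0 ≤ 1 - y := by linarith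
                     positivity)
        (Finset.sum_nonneg fun a _ => mul_nonneg ((M.ϑ_mem s).1 a) (sq_nonneg _))
    rw [e, smul_eq_mul, smul_eq_mul, eq_sub_of_add_eq hxy]
    linarith
  nonneg s D hD := by
    have h : ∑ a, M.ϑ s a * -Real.log (Fintype.card S) ≤
        ∑ a, M.ϑ s a * ∑ s', D a s' * Real.log (D a s') :=
      Finset.sum_le_sum fun a _ => mul_le_mul_of_nonneg_left
        (neg_log_card_le_sum_mul_log (by omega) (hD a)) ((M.ϑ_mem s).1 a)
    rw [← Finset.sum_mul, (M.ϑ_mem s).2, one_mul] at h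
    rw [negEntropy]
    linarith
  le_wbar s D hD := by
    have h : ∑ a, M.ϑ s a * ∑ s', D a s' * Real.log (D a s') ≤ 0 :=
      Finset.sum_nonpos fun a _ => mul_nonpos_of_nonneg_of_nonpos ((M.ϑ_mem s).1 a)
        (sum_mul_log_nonpos (hD a))
    rw [negEntropy]
    linarith
  bregman s D hD D' hD' b hb := by
    set Q := ∑ a, M.ϑ s a * (∑ s', |D a s' - D' a s'|) ^ 2 with hQ
    rw [IsBregman, ← hasDerivWithinAt_Ioi_iff_Ici,
      hasDerivWithinAt_iff_tendsto_slope' self_notMem_Ioi] at hb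
    have hlim : Filter.Tendsto (fun τ : ℝ => M.negEntropy s D' - M.negEntropy s D - (1 - τ) / 2 * Q)
        (nhdsWithin 0 (Ioi 0)) (nhds (M.negEntropy s D' - M.negEntropy s D - (1 - 0) / 2 * Q)) :=
      (Continuous.tendsto (by fun_prop) 0).mono_left nhdsWithin_le_nhds
    -- The segment inequality divided by `τ` passes to the limit `τ → 0` from the right.
    have h := le_of_tendsto_of_tendsto hb hlim (by
      filter_upwards [Ioc_mem_nhdsGT (zero_lt_one' ℝ)] with τ hτ
      have h := M.negEntropy_segment_le s hD hD' (τ := τ) ⟨hτ.1.le, hτ.2⟩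
      rw [slope_def_field, sub_zero, div_le_iff₀ hτ.1, zero_smul, add_zero]
      nlinarith [h])
    linarith

end RobustEval

/-! ### Weights, iteration count, step count and sample count -/

namespace RobustEval

variable {S : Type u} {A : Type v} [Fintype S] [Fintype A]

open Matrix

/-- The nominal parts cancel. This identifies the regret at a state with a difference of one-step
expectations. -/
theorem natureMatrix_mulVec_sub (M : RobustEval S A) (π π' : S → A → S → ℝ) (v : S → ℝ) (s : S) :
    (M.natureMatrix π *ᵥ v) s - (M.natureMatrix π' *ᵥ v) s =
      M.ζ * (M.pairing s v (π s) - M.pairing s v (π' s)) := by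
  have h : ∀ π : S → A → S → ℝ,
      M.pairing s v (π s) = ∑ s', (∑ a, M.ϑ s a * π s a s') * v s' := fun π => by
    rw [pairing_apply, Finset.sum_comm]
    refine Finset.sum_congr rfl fun s' _ => ?_
    rw [Finset.sum_mul]
    exact Finset.sum_congr rfl fun a _ => by ring
  rw [h, h, mulVec, mulVec, dotProduct, dotProduct, ← Finset.sum_sub_distrib,
    ← Finset.sum_sub_distrib, Finset.mul_sum]
  refine Finset.sum_congr rfl fun s' _ => ?_
  rw [natureMatrix_apply, natureMatrix_apply]
  ring

/-- Comparison with the integral of `√x`. With `a = √(k + 1)` and `b = √k`, the induction step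
reduces to `2 b² (a - b) ≤ b ≤ a`. -/
theorem le_sum_tunedBeta (k : ℕ) :
    2 / 3 * (k * Real.sqrt k) ≤ ∑ j ∈ Finset.Icc 1 k, tunedBeta j := by
  induction k with
  | zero => simp
  | succ k ih =>
    rw [Finset.sum_Icc_succ_top (Nat.le_add_left 1 k), tunedBeta]
    have ha : Real.sqrt ((k + 1 : ℕ) : ℝ) ^ 2 = k + 1 := by
      rw [Real.sq_sqrt (Nat.cast_nonneg _)]; push_cast; rfl
    have hb : Real.sqrt (k : ℝ) ^ 2 = k := Real.sq_sqrt (Nat.cast_nonneg _)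
    have ha0 := Real.sqrt_nonneg ((k + 1 : ℕ) : ℝ)
    have hb0 := Real.sqrt_nonneg (k : ℝ)
    have hab : Real.sqrt (k : ℝ) ≤ Real.sqrt ((k + 1 : ℕ) : ℝ) :=
      Real.sqrt_le_sqrt (by push_cast; linarith)
    push_cast at *
    generalize Real.sqrt ((k : ℝ) + 1) = a at *
    generalize Real.sqrt (k : ℝ) = b at *
    rw [← hb] at ha ih ⊢
    have h1 : (a - b) * (a + b) = 1 := by linarith
    have h2 : (a - b) * (2 * b) ≤ 1 := by nlinarith
    have h3 : (a - b) * (2 * b) * b ≤ 1 * b := mul_le_mul_of_nonneg_right h2 hb0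
    nlinarith [h3]

theorem one_le_numIter (M : RobustEval S A) {wbar μw : ℝ} (hw : 0 < wbar) (hμ : 0 < μw) (ε : ℝ) :
    1 ≤ M.numIter wbar μw ε := by
  have hγ : 0 < 1 - M.γ := sub_pos.2 M.γ_lt_one
  refine Nat.le_floor ?_
  rw [Nat.cast_one, le_add_iff_nonneg_right]
  positivity

/-- A number of steps after which the bias of the SE operator is small. -/
noncomputable def stepCount (γ ε : ℝ) : ℕ :=
  ⌈Real.log (2 / ((1 - γ) * ε)) / (1 - γ)⌉₊

/-- From `γ ≤ exp (-(1 - γ))`. Half of the error budget `(1 - γ) ε` goes to the truncation bias. -/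
theorem pow_stepCount_le {γ ε : ℝ} (h0 : 0 ≤ γ) (h1 : γ < 1) (hε : 0 < ε) :
    γ ^ (stepCount γ ε + 1) ≤ (1 - γ) * ε / 2 := by
  have hγ : 0 < 1 - γ := sub_pos.2 h1
  have hl : Real.log (2 / ((1 - γ) * ε)) ≤ stepCount γ ε * (1 - γ) :=
    (div_le_iff₀ hγ).1 (Nat.le_ceil _)
  calc γ ^ (stepCount γ ε + 1) ≤ γ ^ stepCount γ ε :=
        pow_le_pow_of_le_one h0 h1.le (Nat.le_succ _)
    _ ≤ Real.exp (-(1 - γ)) ^ stepCount γ ε :=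
        pow_le_pow_left₀ h0 (by linarith [Real.add_one_le_exp (-(1 - γ))]) _
    _ = Real.exp (-(stepCount γ ε * (1 - γ))) := by rw [← Real.exp_nat_mul, mul_neg]
    _ ≤ Real.exp (-Real.log (2 / ((1 - γ) * ε))) := Real.exp_le_exp.2 (neg_le_neg hl)
    _ = (1 - γ) * ε / 2 := by rw [← Real.log_inv, Real.exp_log (by positivity), inv_div]

/-- As `(1 - γ) ε ≤ 1 / 2`, the logarithm on the right is at least `log 2 > 1 / 2`; so it absorbs
the summand `log 2`, and its double absorbs the rounding. -/
theorem stepCount_le {γ ε : ℝ} (h0 : 0 ≤ γ) (h1 : γ < 1) (hε : 0 < ε) (hε2 : ε ≤ 1 / 2) :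
    (stepCount γ ε : ℝ) ≤ 4 * Real.log (1 / ((1 - γ) * ε)) / (1 - γ) := by
  have hγ : 0 < 1 - γ := sub_pos.2 h1
  have hx : 0 < (1 - γ) * ε := mul_pos hγ hε
  have hx2 : (1 - γ) * ε ≤ 1 / 2 := by nlinarith
  have hL : Real.log 2 ≤ Real.log (1 / ((1 - γ) * ε)) :=
    Real.log_le_log two_pos (by rw [le_div_iff₀ hx]; linarith)
  have h2 : Real.log (2 / ((1 - γ) * ε)) = Real.log 2 + Real.log (1 / ((1 - γ) * ε)) := by
    rw [← Real.log_mul two_ne_zero (by positivity), mul_one_div]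
  have hlog := Real.log_two_gt_d9
  have h3 := Nat.ceil_lt_add_one (a := Real.log (2 / ((1 - γ) * ε)) / (1 - γ))
    (div_nonneg (by linarith) hγ.le)
  refine h3.le.trans ?_
  rw [← le_sub_iff_add_le, div_le_iff₀ hγ, sub_mul _ (1 : ℝ), div_mul_cancel₀ _ hγ.ne']
  linarith

/-- The factor `2` in `hL` covers both logarithms: `ε ≤ 1 - γ` gives `(1 - γ) ε ≥ ε ^ 2`. The
constant is `512 = 64 * 8`. -/
theorem card_sampleIndices_le (M : RobustEval S A) {wbar μw ε L : ℝ} (hw : 0 < wbar)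
    (hμ : 0 < μw) (hε : 0 < ε) (hε2 : ε ≤ 1 / 2)
    (hL : Real.log (1 / ((1 - M.γ) * ε)) ≤ 2 * L) :
    ((sampleIndices S (M.numIter wbar μw ε) (stepCount M.γ ε)).card : ℝ) ≤
      512 * M.sampleBound wbar μw ε L := by
  have hγ : 0 < 1 - M.γ := sub_pos.2 M.γ_lt_one
  have hl := stepCount_le M.γ_nonneg M.γ_lt_one hε hε2
  have hl2 : (stepCount M.γ ε : ℝ) ≤ 8 * L / (1 - M.γ) :=
    hl.trans (div_le_div_of_nonneg_right (by linarith) hγ.le)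
  have hN : ((M.numIter wbar μw ε : ℕ) : ℝ) ≤
      1 + 64 * M.γ ^ 2 * M.ζ ^ 2 * wbar / (μw * (1 - M.γ) ^ 4 * ε ^ 2) :=
    Nat.floor_le (by positivity)
  have hLnn : 0 ≤ 8 * L / (1 - M.γ) := (Nat.cast_nonneg _).trans hl2
  have hL0 : 0 ≤ L := by
    by_contra! h
    exact absurd hLnn (not_le.2 (div_neg_of_neg_of_pos (by linarith) hγ))
  have hcard : ((sampleIndices S (M.numIter wbar μw ε) (stepCount M.γ ε)).card : ℝ) =
      (M.numIter wbar μw ε + 1) * (stepCount M.γ ε * Fintype.card S) := by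
    simp [sampleIndices]
  have hS : (0 : ℝ) ≤ Fintype.card S := Nat.cast_nonneg _
  rw [hcard]
  calc _ ≤ (1 + 64 * M.γ ^ 2 * M.ζ ^ 2 * wbar / (μw * (1 - M.γ) ^ 4 * ε ^ 2) + 1) *
        (8 * L / (1 - M.γ) * Fintype.card S) := by
        gcongr
    _ = 512 * (M.γ ^ 2 * M.ζ ^ 2 * Fintype.card S * wbar * L / (μw * ε ^ 2 * (1 - M.γ) ^ 5)) +
        16 * (Fintype.card S / (1 - M.γ) * L) := by
        field_simp
        ring
    _ ≤ 512 * M.sampleBound wbar μw ε L := by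
        have : 0 ≤ (Fintype.card S : ℝ) / (1 - M.γ) * L := by positivity
        rw [sampleBound]
        linarith

theorem card_sampleIndices_le_of_le_one_sub (M : RobustEval S A) {wbar μw ε : ℝ} (hw : 0 < wbar)
    (hμ : 0 < μw) (hε : 0 < ε) (hε2 : ε ≤ 1 / 2) (hεγ : ε ≤ 1 - M.γ) :
    ((sampleIndices S (M.numIter wbar μw ε) (stepCount M.γ ε)).card : ℝ) ≤
      512 * M.sampleBound wbar μw ε (Real.log (1 / ε)) := by
  refine M.card_sampleIndices_le hw hμ hε hε2 ?_
  rw [one_div, one_div, Real.log_inv, Real.log_inv,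
    Real.log_mul (sub_pos.2 M.γ_lt_one).ne' hε.ne']
  linarith [Real.log_le_log hε hεγ]

theorem card_sampleIndices_le_log (M : RobustEval S A) {wbar μw ε : ℝ} (hw : 0 < wbar)
    (hμ : 0 < μw) (hε : 0 < ε) (hε2 : ε ≤ 1 / 2) :
    ((sampleIndices S (M.numIter wbar μw ε) (stepCount M.γ ε)).card : ℝ) ≤
      512 * M.sampleBound wbar μw ε (Real.log (1 / ((1 - M.γ) * ε))) := by
  have hγ : 0 < 1 - M.γ := sub_pos.2 M.γ_lt_one
  have hx : (1 - M.γ) * ε ≤ 1 := by nlinarith [M.γ_nonneg]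
  refine M.card_sampleIndices_le hw hμ hε hε2 ?_
  linarith [Real.log_nonneg (one_le_one_div (mul_pos hγ hε) hx)]

theorem samples_eq_of_pastIndices {S : Type u} {A : Type v} {Ω : Type w} [Fintype S]
    [DecidableEq S] {Z : ℕ → ℕ → S → Ω → A × S} {t l : ℕ} {ω ω' : Ω}
    (h : ∀ q ∈ pastIndices S t l l, samples Z q ω = samples Z q ω') :
    ∀ q ∈ pastIndices S t l 0, samples Z q ω = samples Z q ω' := fun q hq =>
  h q (by rw [mem_pastIndices] at *; omega)

/-! ### Expected error along a run of SFRPE -/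

section Run

variable [DecidableEq S]
variable {Ω : Type w} {Z : ℕ → ℕ → S → Ω → A × S} {M : RobustEval S A}
  {f : S → (A → S → ℝ) → ℝ} {β lam : ℕ → ℝ} {l : ℕ} {π : ℕ → Ω → S → A → S → ℝ}
  {V : ℕ → Ω → S → ℝ}

theorem IsSFRPERun.dependsOnSamples_policy (hrun : M.IsSFRPERun f β lam l Z π V) (t : ℕ) :
    DependsOnSamples (samples Z) (pastIndices S t l 0) (π t) := fun ω ω' h =>
  hrun.adapted t ω ω' fun t' ht i hi s => h (t', i, s) (by simp [mem_pastIndices, ht, hi])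

theorem IsSFRPERun.dependsOnSamples_estimate (hrun : M.IsSFRPERun f β lam l Z π V) (t : ℕ) :
    DependsOnSamples (samples Z) (pastIndices S t l l) (V t) := fun ω ω' h => by
  funext s
  rw [hrun.evaluate, hrun.evaluate,
    hrun.dependsOnSamples_policy t ω ω' (samples_eq_of_pastIndices h), seEstimate_eq_sum,
    seEstimate_eq_sum]
  refine Finset.sum_congr rfl fun i hi => ?_
  -- `R_i` with `i ≤ l` involves only the steps `j < i`, so no sample beyond the first `l` steps
  -- enters.
  have hR : M.seR (π t ω') (fun i s => (Z t i s ω).2) i =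
      M.seR (π t ω') (fun i s => (Z t i s ω').2) i :=
    M.seR_congr _ fun j hj => funext fun s => congrArg Prod.snd (h (t, j, s) (by
      rw [Finset.mem_range] at hi
      exact mem_pastIndices.2 (Or.inr ⟨rfl, hj.trans_le (Nat.le_of_lt_succ hi)⟩)))
  rw [hR]

variable [MeasurableSpace S] [MeasurableSingletonClass S] [MeasurableSpace A]
  [MeasurableSingletonClass A] [MeasurableSpace Ω] {Pr : Measure Ω} [IsProbabilityMeasure Pr]

theorem IsSFRPERun.integrable_estimate (hrun : M.IsSFRPERun f β lam l Z π V)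
    (hZ : M.IsSimulator Pr Z) (t : ℕ) (s : S) : Integrable (fun ω => V t ω s) Pr :=
  DependsOnSamples.integrable (Z := samples Z) (I := pastIndices S t l l)
    (fun _ => hZ.measurable _ _ _)
    fun ω ω' h => by rw [hrun.dependsOnSamples_estimate t ω ω' h]

theorem IsSFRPERun.integral_mul_estimate (hrun : M.IsSFRPERun f β lam l Z π V)
    (hZ : M.IsSimulator Pr Z) (t : ℕ) {H : Ω → ℝ}
    (hH : DependsOnSamples (samples Z) (pastIndices S t l 0) H) (s : S) :
    ∫ ω, H ω * V t ω s ∂Pr = ∫ ω, H ω * M.truncValue (π t ω) l s ∂Pr := by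
  simp_rw [hrun.evaluate]
  exact hZ.integral_mul_seEstimate (hrun.dependsOnSamples_policy t) hH s

theorem IsSFRPERun.integral_estimate (hrun : M.IsSFRPERun f β lam l Z π V)
    (hZ : M.IsSimulator Pr Z) (t : ℕ) (s : S) :
    ∫ ω, V t ω s ∂Pr = ∫ ω, M.truncValue (π t ω) l s ∂Pr := by
  simpa only [one_mul] using
    hrun.integral_mul_estimate hZ t (H := fun _ => 1) (fun _ _ _ => rfl) s

theorem IsSFRPERun.integrable_truncValue (hrun : M.IsSFRPERun f β lam l Z π V)
    (hZ : M.IsSimulator Pr Z) (t : ℕ) (s : S) :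
    Integrable (fun ω => M.truncValue (π t ω) l s) Pr :=
  DependsOnSamples.integrable (Z := samples Z) (I := pastIndices S t l 0)
    (fun _ => hZ.measurable _ _ _)
    fun ω ω' h => by simp only [hrun.dependsOnSamples_policy t ω ω' h]

theorem IsSFRPERun.natureOpt_le_integral (hrun : M.IsSFRPERun f β lam l Z π V)
    (hZ : M.IsSimulator Pr Z) (t : ℕ) (s : S) : M.natureOpt s ≤ ∫ ω, V t ω s ∂Pr := by
  rw [hrun.integral_estimate hZ]
  have h := integral_mono (integrable_const (M.natureOpt s)) (hrun.integrable_truncValue hZ t s)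
    fun ω => (M.natureOpt_le (hrun.policy t ω) s).trans
      (M.natureValue_le_truncValue (hrun.policy t ω) l s)
  simpa using h

/-- Approximate Bellman equation for the expected estimates. -/
theorem IsSFRPERun.integral_estimate_le (hrun : M.IsSFRPERun f β lam l Z π V)
    (hZ : M.IsSimulator Pr Z) (t : ℕ) (s : S) :
    ∫ ω, V t ω s ∂Pr ≤ M.natureCost s + M.γ ^ (l + 1) +
      M.γ * ∫ ω, (M.natureMatrix (π t ω) *ᵥ V t ω) s ∂Pr := by
  have hmeas : ∀ q, Measurable (samples Z q) := fun q => hZ.measurable _ _ _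
  have i1 : ∀ s', Integrable (fun ω => M.natureMatrix (π t ω) s s' * V t ω s') Pr := fun s' =>
    DependsOnSamples.integrable (Z := samples Z) (I := pastIndices S t l l) hmeas fun ω ω' h => by
      simp only [hrun.dependsOnSamples_estimate t ω ω' h,
        hrun.dependsOnSamples_policy t ω ω' (samples_eq_of_pastIndices h)]
  have i2 : ∀ s', Integrable
      (fun ω => M.natureMatrix (π t ω) s s' * M.truncValue (π t ω) l s') Pr := fun s' =>
    DependsOnSamples.integrable (Z := samples Z) (I := pastIndices S t l 0) hmeas fun ω ω' h => by
      simp only [hrun.dependsOnSamples_policy t ω ω' h]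
  -- `V t` is correlated with `π t`, but the entries of the transition matrix are determined by the
  -- past and can serve as the weight in unbiasedness.
  have e : ∫ ω, (M.natureMatrix (π t ω) *ᵥ V t ω) s ∂Pr =
      ∫ ω, (M.natureMatrix (π t ω) *ᵥ M.truncValue (π t ω) l) s ∂Pr := by
    simp only [mulVec, dotProduct]
    rw [integral_finsetSum _ fun s' _ => i1 s', integral_finsetSum _ fun s' _ => i2 s']
    refine Finset.sum_congr rfl fun s' _ => hrun.integral_mul_estimate hZ t (fun ω ω' h => ?_) s'
    simp only [hrun.dependsOnSamples_policy t ω ω' h]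
  have i3 : Integrable (fun ω => (M.natureMatrix (π t ω) *ᵥ M.truncValue (π t ω) l) s) Pr :=
    integrable_finsetSum _ fun s' _ => i2 s'
  rw [hrun.integral_estimate hZ, e]
  have h := integral_mono (hrun.integrable_truncValue hZ t s)
    ((integrable_const (M.natureCost s + M.γ ^ (l + 1))).add (i3.const_mul M.γ))
    fun ω => M.truncValue_le (hrun.policy t ω) l s
  refine h.trans_eq ?_
  simp only [Pi.add_apply]
  rw [integral_add (integrable_const _) (i3.const_mul M.γ), integral_const_mul]
  simp

/-- A regret bound turns into a bound on the expected error of the weighted estimate. -/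
theorem IsSFRPERun.sum_integral_sub_natureOpt_le (hrun : M.IsSFRPERun f β lam l Z π V)
    (hZ : M.IsSimulator Pr Z) {k : ℕ} {θ : ℕ → ℝ} (hθ : ∀ t, 0 ≤ θ t)
    (hθ1 : ∑ t ∈ Finset.Icc 1 k, θ t = 1) {r : ℝ}
    (hreg : ∀ ω s, ∀ D ∈ M.amb s, M.γ * M.ζ * ∑ t ∈ Finset.Icc 1 k,
      θ t * (M.pairing s (V t ω) (π t ω s) - M.pairing s (V t ω) D) ≤ r) (s : S) :
    ∑ t ∈ Finset.Icc 1 k, θ t * ∫ ω, V t ω s ∂Pr - M.natureOpt s ≤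
      (M.γ ^ (l + 1) + r) / (1 - M.γ) := by
  have hmeas : ∀ q, Measurable (samples Z q) := fun q => hZ.measurable _ _ _
  set X : S → ℝ := fun s => ∑ t ∈ Finset.Icc 1 k, θ t * ∫ ω, V t ω s ∂Pr with hX
  suffices h : X s - (M.γ ^ (l + 1) + r) / (1 - M.γ) ≤ M.natureOpt s by linarith
  refine M.le_natureOpt fun π' hπ' => ?_
  -- It suffices that `X - V^{π'}` is an approximate subsolution of the discounted equation of the
  -- fixed chain `π'`.
  have hcomp := le_div_of_sub_mulVec_le (M.natureMatrix_mem hπ') M.γ_nonneg M.γ_lt_one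
    (x := X - M.natureValue π') (c := M.γ ^ (l + 1) + r) (fun s => ?_) s
  · rw [Pi.sub_apply] at hcomp
    linarith
  have hQ : ∀ t, Integrable (fun ω => (M.natureMatrix (π t ω) *ᵥ V t ω) s) Pr := fun t =>
    DependsOnSamples.integrable (Z := samples Z) (I := pastIndices S t l l) hmeas fun ω ω' h => by
      simp only [hrun.dependsOnSamples_estimate t ω ω' h,
        hrun.dependsOnSamples_policy t ω ω' (samples_eq_of_pastIndices h)]
  have hQ' : ∀ t, Integrable (fun ω => (M.natureMatrix π' *ᵥ V t ω) s) Pr := fun t =>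
    DependsOnSamples.integrable (Z := samples Z) (I := pastIndices S t l l) hmeas fun ω ω' h => by
      simp only [hrun.dependsOnSamples_estimate t ω ω' h]
  have h1 : X s ≤ M.natureCost s + M.γ ^ (l + 1) + M.γ *
      ∑ t ∈ Finset.Icc 1 k, θ t * ∫ ω, (M.natureMatrix (π t ω) *ᵥ V t ω) s ∂Pr := by
    calc X s ≤ ∑ t ∈ Finset.Icc 1 k, θ t * (M.natureCost s + M.γ ^ (l + 1) +
          M.γ * ∫ ω, (M.natureMatrix (π t ω) *ᵥ V t ω) s ∂Pr) :=
        Finset.sum_le_sum fun t _ =>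
          mul_le_mul_of_nonneg_left (hrun.integral_estimate_le hZ t s) (hθ t)
      _ = _ := by
        simp only [mul_add (θ _), Finset.sum_add_distrib, ← Finset.sum_mul, hθ1, one_mul,
          mul_left_comm (θ _), ← Finset.mul_sum]
  have h2 : (M.natureMatrix π' *ᵥ X) s =
      ∑ t ∈ Finset.Icc 1 k, θ t * ∫ ω, (M.natureMatrix π' *ᵥ V t ω) s ∂Pr := by
    simp only [mulVec, dotProduct, hX, Finset.mul_sum]
    rw [Finset.sum_comm]
    refine Finset.sum_congr rfl fun t _ => ?_
    rw [integral_finsetSum _ fun s' _ => (hrun.integrable_estimate hZ t s').const_mul _,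
      Finset.mul_sum]
    refine Finset.sum_congr rfl fun s' _ => ?_
    rw [integral_const_mul]
    ring
  -- The regret bound holds for every realization and `π'` is deterministic, so integration suffices
  -- here.
  have h3 : M.γ * ∑ t ∈ Finset.Icc 1 k, θ t * ∫ ω, (M.natureMatrix (π t ω) *ᵥ V t ω) s ∂Pr -
      M.γ * ∑ t ∈ Finset.Icc 1 k, θ t * ∫ ω, (M.natureMatrix π' *ᵥ V t ω) s ∂Pr ≤ r := by
    rw [← mul_sub, ← Finset.sum_sub_distrib]
    have e : ∀ t ∈ Finset.Icc 1 k, θ t * ∫ ω, (M.natureMatrix (π t ω) *ᵥ V t ω) s ∂Pr -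
        θ t * ∫ ω, (M.natureMatrix π' *ᵥ V t ω) s ∂Pr =
        ∫ ω, θ t * ((M.natureMatrix (π t ω) *ᵥ V t ω) s - (M.natureMatrix π' *ᵥ V t ω) s) ∂Pr :=
      fun t _ => by rw [integral_const_mul, integral_sub (hQ t) (hQ' t), mul_sub]
    have hi : ∀ t ∈ Finset.Icc 1 k, Integrable (fun ω => θ t *
        ((M.natureMatrix (π t ω) *ᵥ V t ω) s - (M.natureMatrix π' *ᵥ V t ω) s)) Pr :=
      fun t _ => ((hQ t).sub (hQ' t)).const_mul (θ t)
    rw [Finset.sum_congr rfl e, ← integral_finsetSum _ hi, ← integral_const_mul]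
    have h := integral_mono ((integrable_finsetSum _ hi).const_mul M.γ)
      (integrable_const (μ := Pr) r)
      fun ω => by
        refine le_trans (le_of_eq ?_) (hreg ω s (π' s) (hπ' s))
        simp only [natureMatrix_mulVec_sub, mul_left_comm (θ _), ← Finset.mul_sum,
          mul_assoc]
    simpa using h
  have h4 := M.natureValue_eq hπ' s
  rw [mulVec_sub, Pi.sub_apply, Pi.sub_apply, h2]
  linarith

/-- The output of SFRPE with the tuned parameters is an `ε`-estimator of the optimal value. -/
theorem IsDGF.isEstimator_output {wbar μw ε : ℝ} (hf : M.IsDGF f wbar μw) (hε : 0 < ε)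
    (hZ : M.IsSimulator Pr Z)
    (hrun : M.IsSFRPERun f tunedBeta (M.tunedLam wbar μw) l Z π V)
    (hl : M.γ ^ (l + 1) ≤ (1 - M.γ) * ε / 2) {k : ℕ} (hk : M.numIter wbar μw ε ≤ k) :
    IsEstimator Pr (output tunedBeta V k) M.natureOpt ε := by
  have hγ : 0 < 1 - M.γ := sub_pos.2 M.γ_lt_one
  have hη : 0 ≤ M.γ * M.ζ := mul_nonneg M.γ_nonneg M.ζ_mem.1
  have hw := hf.wbar_pos
  have hμ := hf.μw_pos
  have hk1 : 1 ≤ k := (M.one_le_numIter hw hμ ε).trans hk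
  have hk0 : (0 : ℝ) < k := by exact_mod_cast hk1
  set B := ∑ j ∈ Finset.Icc 1 k, tunedBeta j with hB
  have hBk : 2 / 3 * (k * Real.sqrt k) ≤ B := le_sum_tunedBeta k
  have hsk : 0 < Real.sqrt k := Real.sqrt_pos.2 hk0
  have hB0 : 0 < B := lt_of_lt_of_le (by positivity) hBk
  have hβ : ∀ t, 0 ≤ tunedBeta t := fun t => Real.sqrt_nonneg _
  have hθ : ∀ t, 0 ≤ tunedBeta t / B := fun t => div_nonneg (hβ t) hB0.le
  have hθ1 : ∑ t ∈ Finset.Icc 1 k, tunedBeta t / B = 1 := by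
    rw [← Finset.sum_div, ← hB, div_self hB0.ne']
  -- The square root of the defining inequality of `numIter`; the summand `1` there compensates for
  -- the integer part.
  have hq : 8 * (M.γ * M.ζ * Real.sqrt (wbar / μw)) ≤ Real.sqrt k * ((1 - M.γ) ^ 2 * ε) := by
    have h1 : 64 * M.γ ^ 2 * M.ζ ^ 2 * wbar / (μw * (1 - M.γ) ^ 4 * ε ^ 2) ≤ k := by
      have h := Nat.lt_floor_add_one
        (1 + 64 * M.γ ^ 2 * M.ζ ^ 2 * wbar / (μw * (1 - M.γ) ^ 4 * ε ^ 2))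
      have h' : ((M.numIter wbar μw ε : ℕ) : ℝ) ≤ k := by exact_mod_cast hk
      rw [numIter] at h'
      linarith
    have h2 := Real.sqrt_le_sqrt h1
    have e : 64 * M.γ ^ 2 * M.ζ ^ 2 * wbar / (μw * (1 - M.γ) ^ 4 * ε ^ 2) =
        (8 * (M.γ * M.ζ) / ((1 - M.γ) ^ 2 * ε)) ^ 2 * (wbar / μw) := by
      field_simp
      ring
    rw [e, Real.sqrt_mul (sq_nonneg _), Real.sqrt_sq (by positivity), div_mul_eq_mul_div,
      div_le_iff₀ (by positivity)] at h2
    linarith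
  -- The constant is `3 / 8 = 2 / (8 * (2 / 3))`: regret factor `2`, the `8` from `hq`, and `2 / 3`
  -- from the sum of weights. With the bias `1 / 2` the total is `7 / 8 < 1`.
  have hreg : ∀ ω s, ∀ D ∈ M.amb s, M.γ * M.ζ * ∑ t ∈ Finset.Icc 1 k,
      tunedBeta t / B * (M.pairing s (V t ω) (π t ω s) - M.pairing s (V t ω) D) ≤
        3 / 8 * ((1 - M.γ) * ε) := fun ω s D hD => by
    have h := hf.tuned_regret (V := fun t => V t ω) (π := fun t => π t ω)
      (fun t s => by rw [hrun.evaluate]; exact M.abs_seEstimate_le (hrun.policy t ω) _ l s)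
      (fun t => hrun.policy t ω) (fun k => hrun.update k ω s) hD hk1
    have e : M.γ * M.ζ * ∑ t ∈ Finset.Icc 1 k,
        tunedBeta t / B * (M.pairing s (V t ω) (π t ω s) - M.pairing s (V t ω) D) =
        (M.γ * M.ζ * ∑ t ∈ Finset.Icc 1 k,
          tunedBeta t * (M.pairing s (V t ω) (π t ω s) - M.pairing s (V t ω) D)) / B := by
      rw [mul_div_assoc, Finset.sum_div]
      congr 1
      exact Finset.sum_congr rfl fun t _ => by ring
    rw [e, div_le_iff₀ hB0]
    refine h.trans ?_
    have h2 : M.γ * M.ζ * Real.sqrt (wbar / μw) / (1 - M.γ) ≤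
        Real.sqrt k * ((1 - M.γ) * ε) / 8 := by
      rw [div_le_iff₀ hγ]
      linarith
    have h3 := mul_le_mul_of_nonneg_left h2 (mul_nonneg zero_le_two hk0.le)
    have h4 := mul_le_mul_of_nonneg_right hBk (mul_pos hγ hε).le
    linarith
  intro s
  have hint : ∀ t ∈ Finset.Icc 1 k, Integrable (fun ω => tunedBeta t / B * V t ω s) Pr :=
    fun t _ => (hrun.integrable_estimate hZ t s).const_mul _
  have hE : ∫ ω, output tunedBeta V k ω s ∂Pr =
      ∑ t ∈ Finset.Icc 1 k, tunedBeta t / B * ∫ ω, V t ω s ∂Pr := by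
    simp only [output]
    rw [integral_finsetSum _ hint]
    exact Finset.sum_congr rfl fun t _ => integral_const_mul _ _
  refine ⟨integrable_finsetSum _ hint, ?_, ?_⟩
  · have h : ∑ t ∈ Finset.Icc 1 k, tunedBeta t / B * M.natureOpt s ≤
        ∑ t ∈ Finset.Icc 1 k, tunedBeta t / B * ∫ ω, V t ω s ∂Pr :=
      Finset.sum_le_sum fun t _ =>
        mul_le_mul_of_nonneg_left (hrun.natureOpt_le_integral hZ t s) (hθ t)
    rw [← Finset.sum_mul, hθ1, one_mul] at h
    rw [hE]
    linarith
  · rw [hE]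
    refine (hrun.sum_integral_sub_natureOpt_le hZ hθ hθ1 hreg s).trans ?_
    rw [div_le_iff₀ hγ]
    linarith [mul_pos hγ hε]

end Run

end RobustEval

theorem mainTheorem4 :
    ∃ (C : ℝ) (len : ℝ → ℝ → ℕ), 0 < C ∧
    ∀ (S : Type u) (A : Type v) [Fintype S] [DecidableEq S] [Fintype A]
      [MeasurableSpace S] [MeasurableSingletonClass S]
      [MeasurableSpace A] [MeasurableSingletonClass A]
      (M : RobustEval S A)
      (Ω : Type w) [MeasurableSpace Ω] (Pr : Measure Ω) [IsProbabilityMeasure Pr]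
      (Z : ℕ → ℕ → S → Ω → A × S), M.IsSimulator Pr Z →
    -- the optimal value of nature is the negative of the robust value
    (∀ s, M.natureOpt s = -M.robustValue s) ∧
    -- general distance generating functions
    (∀ (f : S → (A → S → ℝ) → ℝ) (wbar μw : ℝ), M.IsDGF f wbar μw → ∀ ε : ℝ, 0 < ε →
      (∀ (π : ℕ → Ω → S → A → S → ℝ) (V : ℕ → Ω → S → ℝ),
        M.IsSFRPERun f RobustEval.tunedBeta (M.tunedLam wbar μw) (len M.γ ε) Z π V →
        ∀ k, M.numIter wbar μw ε ≤ k →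
          RobustEval.IsEstimator Pr (RobustEval.output RobustEval.tunedBeta V k)
            M.natureOpt ε) ∧
      (ε ≤ 1 / 2 →
        ((RobustEval.sampleIndices S (M.numIter wbar μw ε) (len M.γ ε)).card : ℝ) ≤
          C * M.sampleBound wbar μw ε (Real.log (1 / ((1 - M.γ) * ε)))) ∧
      (ε ≤ 1 / 2 → ε ≤ 1 - M.γ →
        ((RobustEval.sampleIndices S (M.numIter wbar μw ε) (len M.γ ε)).card : ℝ) ≤
          C * M.sampleBound wbar μw ε (Real.log (1 / ε)))) ∧
    -- the weighted negative entropy, with `wbar = log |S|` and `μw = 1`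
    (2 ≤ Fintype.card S → ∀ ε : ℝ, 0 < ε →
      (∀ (π : ℕ → Ω → S → A → S → ℝ) (V : ℕ → Ω → S → ℝ),
        M.IsSFRPERun M.negEntropy RobustEval.tunedBeta
          (M.tunedLam (Real.log (Fintype.card S)) 1) (len M.γ ε) Z π V →
        ∀ k, M.numIter (Real.log (Fintype.card S)) 1 ε ≤ k →
          RobustEval.IsEstimator Pr (RobustEval.output RobustEval.tunedBeta V k)
            M.natureOpt ε) ∧
      (ε ≤ 1 / 2 →
        ((RobustEval.sampleIndices S (M.numIter (Real.log (Fintype.card S)) 1 ε)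
            (len M.γ ε)).card : ℝ) ≤
          C * M.sampleBound (Real.log (Fintype.card S)) 1 ε
            (Real.log (1 / ((1 - M.γ) * ε)))) ∧
      (ε ≤ 1 / 2 → ε ≤ 1 - M.γ →
        ((RobustEval.sampleIndices S (M.numIter (Real.log (Fintype.card S)) 1 ε)
            (len M.γ ε)).card : ℝ) ≤
          C * M.sampleBound (Real.log (Fintype.card S)) 1 ε (Real.log (1 / ε)))) := by
  refine ⟨512, RobustEval.stepCount, by norm_num, ?_⟩
  intro S A _ _ _ _ _ _ _ M Ω _ Pr _ Z hZ
  have main : ∀ (f : S → (A → S → ℝ) → ℝ) (wbar μw : ℝ), M.IsDGF f wbar μw → ∀ ε : ℝ, 0 < ε →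
      (∀ (π : ℕ → Ω → S → A → S → ℝ) (V : ℕ → Ω → S → ℝ),
        M.IsSFRPERun f RobustEval.tunedBeta (M.tunedLam wbar μw) (RobustEval.stepCount M.γ ε)
          Z π V → ∀ k, M.numIter wbar μw ε ≤ k →
          RobustEval.IsEstimator Pr (RobustEval.output RobustEval.tunedBeta V k)
            M.natureOpt ε) ∧
      (ε ≤ 1 / 2 → ((RobustEval.sampleIndices S (M.numIter wbar μw ε)
          (RobustEval.stepCount M.γ ε)).card : ℝ) ≤
        512 * M.sampleBound wbar μw ε (Real.log (1 / ((1 - M.γ) * ε)))) ∧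
      (ε ≤ 1 / 2 → ε ≤ 1 - M.γ → ((RobustEval.sampleIndices S (M.numIter wbar μw ε)
          (RobustEval.stepCount M.γ ε)).card : ℝ) ≤
        512 * M.sampleBound wbar μw ε (Real.log (1 / ε))) :=
    fun f wbar μw hf ε hε =>
      ⟨fun π V hrun k hk => hf.isEstimator_output hε hZ hrun
        (RobustEval.pow_stepCount_le M.γ_nonneg M.γ_lt_one hε) hk,
        M.card_sampleIndices_le_log hf.wbar_pos hf.μw_pos hε,
        M.card_sampleIndices_le_of_le_one_sub hf.wbar_pos hf.μw_pos hε⟩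
  exact ⟨M.natureOpt_eq_neg_robustValue, main, fun hS => main _ _ _ (M.isDGF_negEntropy hS)⟩
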